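/- Let $\mathfrak g$ be a finite-dimensional complex reductive Lie algebra, with tensor algebra $T(\mathfrak g)$, exterior algebra $\wedge\mathfrak g$, symmetric algebra $P(\mathfrak g)$ and universal enveloping algebra $U(\mathfrak g)$. Let $\tau:T(\mathfrak g)\to U(\mathfrak g)$ be the quotient map and let $S(\mathfrak g)\subset T(\mathfrak g)$ be the space of symmetric tensors; by the Poincaré–Birkhoff–Witt theorem $\tau$ restricts to a linear isomorphism $S(\mathfrak g)\to U(\mathfrak g)$. Define the linear map $\Gamma:\wedge^{\mathrm{even}}\mathfrak g\to P(\mathfrak g)$ as follows: for $u\in\wedge^{\mathrm{even}}\mathfrak g$ let $a\in T(\mathfrak g)$ be the alternating tensor whose image in $\wedge\mathfrak g$ is $u$, let $s\in S(\mathfrak g)$ be the symmetric tensor with $\tau(s)=\tau(a)$, and let $\Gamma(u)$ be the image of $s$ in $P(\mathfrak g)$. For an integer $k\ge 0$ put $R^k(\mathfrak g)=\Gamma(\wedge^{2k}\mathfrak g)$. Let $\mathrm{Sym}(2k,2)$ be the subgroup of $\mathrm{Sym}(2k)$ of the permutations that permute the set of unordered pairs $\{1,2\},\{3,4\},\dots,\{2k-1,2k\}$,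 and let $\Pi(k)$ be a cross-section of the left cosets $\nu\,\mathrm{Sym}(2k,2)$ in $\mathrm{Sym}(2k)$ that consists of even permutations. (Such $\Pi(k)$ exist, and $\nu\mapsto\{\{\nu(1),\nu(2)\},\dots,\{\nu(2k-1),\nu(2k)\}\}$ is a bijection of $\Pi(k)$ with the set of perfect matchings of $\{1,\dots,2k\}$.) Let $B$ be a nonsingular symmetric invariant bilinear form on $\mathfrak g$ (for instance the Killing form, if $\mathfrak g$ is semisimple). For $x\in\mathfrak g$ let $\partial_x$ be the derivation of $P(\mathfrak g)$ with $\partial_x y=B(x,y)$ for $y\in\mathfrak g$, and extend $x\mapsto\partial_x$ to an algebra homomorphism $p\mapsto\partial_p$ from $P(\mathfrak g)$ to the algebra of differential operators with constant coefficients. An element $q\in P(\mathfrak g)$ is harmonic if $\partial_p q=0$ for every $\mathfrak g$-invariant $p\in P(\mathfrak g)$ with zero constant term. Theorem. For every integer $k\ge 0$ there exists a nonzero scalar $c_k$ such that for all $x_1,\dots,x_{2k}\in\mathfrak g$ $$\Gamma(x_1\wedge\cdots\wedge x_{2k})=c_k\sum_{\nu\in\Pi(k)}[x_{\nu(1)},x_{\nu(2)}]\cdots[x_{\nu(2k-1)},x_{\nu(2k)}],$$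 where the products on the right side are taken in $P(\mathfrak g)$. Furthermore, the sum on the right side is homogeneous of degree $k$ and harmonic, and $R^k(\mathfrak g)$ is the span of all these sums, for arbitrary $x_1,\dots,x_{2k}\in\mathfrak g$. -/

import Mathlib

open scoped Pointwise

noncomputable section

namespace KostantGamma

/-! ### The map `Γ`, for a complex Lie algebra `g` -/

section Gamma

variable (g : Type*) [LieRing g] [LieAlgebra ℂ g]

/-- A Lie algebra is reductive if its radical is its center. -/
def IsReductive : Prop := LieAlgebra.radical ℂ g = LieAlgebra.center ℂ g

/-- The space `S(g) ⊆ T(g)` of symmetric tensors: the span of all the symmetrizations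
`∑ σ, x (σ 0) ⊗ ⋯ ⊗ x (σ (n - 1))`. -/
def symTensors : Submodule ℂ (TensorAlgebra ℂ g) :=
  Submodule.span ℂ {t | ∃ (n : ℕ) (x : Fin n → g),
    t = ∑ σ : Equiv.Perm (Fin n), TensorAlgebra.tprod ℂ g n (fun i => x (σ i))}

/-- The inverse of the isomorphism from alternating tensors onto the exterior algebra:
`x 0 ∧ ⋯ ∧ x (n - 1) ↦ (1 / n!) ∑ σ, sign σ • x (σ 0) ⊗ ⋯ ⊗ x (σ (n - 1))`. -/
def altTensor : ExteriorAlgebra ℂ g →ₗ[ℂ] TensorAlgebra ℂ g :=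
  ExteriorAlgebra.liftAlternating (fun n =>
    ((n.factorial : ℂ)⁻¹) • MultilinearMap.alternatization (TensorAlgebra.tprod ℂ g n))

/-- The quotient map `τ : T(g) → U(g)`, restricted to the symmetric tensors. It is a linear
isomorphism `S(g) ≃ U(g)`, by the Poincaré–Birkhoff–Witt theorem. -/
def symToEnveloping : symTensors g →ₗ[ℂ] UniversalEnvelopingAlgebra ℂ g :=
  (UniversalEnvelopingAlgebra.mkAlgHom ℂ g).toLinearMap ∘ₗ (symTensors g).subtype

/-- `Γ_T`, on all of `T(g)`: the tensor `t` is sent to the symmetric tensor with the same image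
in `U(g)`. (The left inverse of the bijection `symToEnveloping` is its inverse.) -/
def gammaT : TensorAlgebra ℂ g →ₗ[ℂ] symTensors g :=
  (symToEnveloping g).leftInverse ∘ₗ (UniversalEnvelopingAlgebra.mkAlgHom ℂ g).toLinearMap

/-- The map `Γ` from the exterior algebra to the symmetric algebra `P(g)`: identify `∧ g` with the
alternating tensors, apply `Γ_T`, and project the symmetric tensor so obtained to `P(g)`. Only its
restriction to elements of even degree is of interest. -/
def Gamma : ExteriorAlgebra ℂ g →ₗ[ℂ] SymmetricAlgebra ℂ g :=
  (SymmetricAlgebra.algHom ℂ g).toLinearMap ∘ₗ (symTensors g).subtype ∘ₗ gammaT g ∘ₗ altTensor g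

/-- `R^k(g)`, the image of `∧^{2k} g` under `Γ`. -/
def R (k : ℕ) : Submodule ℂ (SymmetricAlgebra ℂ g) :=
  Submodule.map (Gamma g) (⋀[ℂ]^(2 * k) g)

/-- `P^k(g)`, the homogeneous elements of degree `k` of the symmetric algebra. -/
def homogeneous (k : ℕ) : Submodule ℂ (SymmetricAlgebra ℂ g) :=
  LinearMap.range (SymmetricAlgebra.ι ℂ g) ^ k

end Gamma

/-! ### Derivations of the symmetric algebra, invariants and harmonic elements -/

section Harmonic

variable {V : Type*} [AddCommGroup V] [Module ℂ V]

/-- The algebra map `p ↦ p + ε D p` whose `ε`-part is the derivation extending `f`. -/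
def derivAux (f : V →ₗ[ℂ] SymmetricAlgebra ℂ V) :
    SymmetricAlgebra ℂ V →ₐ[ℂ] TrivSqZeroExt (SymmetricAlgebra ℂ V) (SymmetricAlgebra ℂ V) :=
  SymmetricAlgebra.lift
    ((TrivSqZeroExt.inlAlgHom ℂ (SymmetricAlgebra ℂ V) (SymmetricAlgebra ℂ V)).toLinearMap ∘ₗ
        SymmetricAlgebra.ι ℂ V +
      (TrivSqZeroExt.inrHom (SymmetricAlgebra ℂ V) (SymmetricAlgebra ℂ V)).restrictScalars ℂ ∘ₗ f)

theorem derivAux_fst (f : V →ₗ[ℂ] SymmetricAlgebra ℂ V) (p : SymmetricAlgebra ℂ V) :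
    (derivAux f p).fst = p := by
  have h : (TrivSqZeroExt.fstHom ℂ (SymmetricAlgebra ℂ V) (SymmetricAlgebra ℂ V)).comp
      (derivAux f) = AlgHom.id ℂ _ := by
    apply SymmetricAlgebra.algHom_ext
    ext v
    simp [derivAux]
  exact congrArg (fun F => F p) h

/-- The derivation of the symmetric algebra of `V` that extends a linear map on `V`. -/
def deriv (f : V →ₗ[ℂ] SymmetricAlgebra ℂ V) :
    Derivation ℂ (SymmetricAlgebra ℂ V) (SymmetricAlgebra ℂ V) :=
  Derivation.mk'
    ((TrivSqZeroExt.sndHom (SymmetricAlgebra ℂ V) (SymmetricAlgebra ℂ V)).restrictScalars ℂ ∘ₗ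
      (derivAux f).toLinearMap)
    (fun a b => by simp [derivAux_fst, mul_comm])

theorem deriv_ι (f : V →ₗ[ℂ] SymmetricAlgebra ℂ V) (v : V) :
    deriv f (SymmetricAlgebra.ι ℂ V v) = f v := by
  simp [deriv, derivAux]

/-- The partial derivative `∂_x`: the derivation of the symmetric algebra with
`∂_x y = B x y` for `y ∈ V`. -/
def partialD (B : LinearMap.BilinForm ℂ V) (x : V) :
    Derivation ℂ (SymmetricAlgebra ℂ V) (SymmetricAlgebra ℂ V) :=
  deriv (Algebra.linearMap ℂ (SymmetricAlgebra ℂ V) ∘ₗ B x)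

theorem derivation_ext {D D' : Derivation ℂ (SymmetricAlgebra ℂ V) (SymmetricAlgebra ℂ V)}
    (h : ∀ v, D (SymmetricAlgebra.ι ℂ V v) = D' (SymmetricAlgebra.ι ℂ V v)) : D = D' := by
  ext p
  induction p using SymmetricAlgebra.induction with
  | algebraMap r => simp
  | ι v => exact h v
  | mul a b ha hb => simp [ha, hb]
  | add a b ha hb => simp [ha, hb]

/-- `x ↦ ∂_x`, as a linear map to the endomorphisms of the symmetric algebra. -/
def partialLin (B : LinearMap.BilinForm ℂ V) : V →ₗ[ℂ] Module.End ℂ (SymmetricAlgebra ℂ V) where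
  toFun x := (partialD B x : SymmetricAlgebra ℂ V →ₗ[ℂ] SymmetricAlgebra ℂ V)
  map_add' x y := by
    have h : partialD B (x + y) = partialD B x + partialD B y :=
      derivation_ext fun v => by simp [partialD, deriv_ι]
    rw [h]; rfl
  map_smul' c x := by
    have h : partialD B (c • x) = c • partialD B x :=
      derivation_ext fun v => by simp [partialD, deriv_ι, Algebra.smul_def]
    rw [h]; rfl

theorem partialLin_comm (B : LinearMap.BilinForm ℂ V) (x y : V) :
    partialLin B x * partialLin B y = partialLin B y * partialLin B x := by
  have h : ⁅partialD B x, partialD B y⁆ = 0 :=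
    derivation_ext fun v => by simp [Derivation.commutator_apply, partialD, deriv_ι]
  ext p
  have hp := congrArg (fun D => D p) h
  simp only [Derivation.commutator_apply, Derivation.zero_apply, sub_eq_zero] at hp
  exact hp

/-- The algebra of differential operators with constant coefficients on the symmetric algebra:
the subalgebra of endomorphisms generated by the partial derivatives `∂_x`. -/
abbrev DiffOps (B : LinearMap.BilinForm ℂ V) :
    Subalgebra ℂ (Module.End ℂ (SymmetricAlgebra ℂ V)) :=
  Algebra.adjoin ℂ (Set.range (partialLin B))

instance diffOpsCommRing (B : LinearMap.BilinForm ℂ V) : CommRing (DiffOps B) :=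
  { (DiffOps B).toRing with
    mul_comm := (Algebra.isMulCommutative_adjoin ℂ (by
      rintro _ ⟨x, rfl⟩ _ ⟨y, rfl⟩
      exact partialLin_comm B x y)).is_comm.comm }

/-- The algebra homomorphism `q ↦ ∂_q` from the symmetric algebra to the differential operators
with constant coefficients that extends `x ↦ ∂_x`. -/
def diffOp (B : LinearMap.BilinForm ℂ V) : SymmetricAlgebra ℂ V →ₐ[ℂ] DiffOps B :=
  SymmetricAlgebra.lift
    (LinearMap.codRestrict (Subalgebra.toSubmodule (DiffOps B)) (partialLin B)
      (fun x => Algebra.subset_adjoin ⟨x, rfl⟩))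

variable {g : Type*} [LieRing g] [LieAlgebra ℂ g]

/-- The action of `x ∈ g` on the symmetric algebra `P(g)`: the derivation extending `ad x`. -/
def adP (x : g) : Derivation ℂ (SymmetricAlgebra ℂ g) (SymmetricAlgebra ℂ g) :=
  deriv (SymmetricAlgebra.ι ℂ g ∘ₗ (LieAlgebra.ad ℂ g x : g →ₗ[ℂ] g))

/-- `p ∈ J = P(g)^g`. -/
def IsInvariant (p : SymmetricAlgebra ℂ g) : Prop := ∀ x : g, adP x p = 0

/-- The bilinear form `B` on `g` is symmetric, nonsingular and invariant. -/
structure IsInvariantForm (B : LinearMap.BilinForm ℂ g) : Prop where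
  symm : ∀ x y, B x y = B y x
  nondegenerate : B.Nondegenerate
  invariant : ∀ x y z, B ⁅x, y⁆ z = B x ⁅y, z⁆

/-- `q ∈ P(g)` is harmonic if `∂_p q = 0` for all invariant `p` with zero constant term. -/
def IsHarmonic (B : LinearMap.BilinForm ℂ g) (q : SymmetricAlgebra ℂ g) : Prop :=
  ∀ p : SymmetricAlgebra ℂ g, IsInvariant p → SymmetricAlgebra.algebraMapInv p = 0 →
    (diffOp B p : Module.End ℂ (SymmetricAlgebra ℂ g)) q = 0

end Harmonic

/-! ### The sum over perfect matchings -/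

section Matchings

/-- The first element of the `i`-th pair `{2 i, 2 i + 1}` in `Fin (2 * k)`. -/
def fstIdx {k : ℕ} (i : Fin k) : Fin (2 * k) := ⟨2 * i, by omega⟩

/-- The second element of the `i`-th pair `{2 i, 2 i + 1}` in `Fin (2 * k)`. -/
def sndIdx {k : ℕ} (i : Fin k) : Fin (2 * k) := ⟨2 * i + 1, by omega⟩

/-- The set of the unordered pairs `{0, 1}, {2, 3}, …, {2 k - 2, 2 k - 1}`. -/
def stdPairs (k : ℕ) : Set (Set (Fin (2 * k))) :=
  Set.range fun i : Fin k => {fstIdx i, sndIdx i}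

/-- `Sym(2k, 2)`: the permutations that permute the set of the standard unordered pairs. -/
def pairSubgroup (k : ℕ) : Subgroup (Equiv.Perm (Fin (2 * k))) :=
  MulAction.stabilizer (Equiv.Perm (Fin (2 * k))) (stdPairs k)

/-- `N` is a cross-section of the left cosets of `Sym(2k, 2)` in `Sym(2k)` (every permutation is
`ν * h` for exactly one `ν ∈ N` and one `h ∈ Sym(2k, 2)`) that consists of even permutations. -/
structure IsEvenCrossSection (k : ℕ) (N : Finset (Equiv.Perm (Fin (2 * k)))) : Prop where
  isComplement : Subgroup.IsComplement
    (N : Set (Equiv.Perm (Fin (2 * k)))) (pairSubgroup k : Set (Equiv.Perm (Fin (2 * k))))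
  even : ∀ ν ∈ N, Equiv.Perm.sign ν = 1

/-- Such cross-sections exist. -/
theorem exists_isEvenCrossSection (k : ℕ) : ∃ N, IsEvenCrossSection k N := by
  classical
  obtain ⟨τ, hτ, hs⟩ : ∃ τ ∈ pairSubgroup k, k = 0 ∨ Equiv.Perm.sign τ = -1 := by
    rcases Nat.eq_zero_or_pos k with hk | hk
    · exact ⟨1, one_mem _, Or.inl hk⟩
    · let i0 : Fin k := ⟨0, hk⟩
      have hne : fstIdx i0 ≠ sndIdx i0 := by simp [fstIdx, sndIdx]
      refine ⟨Equiv.swap (fstIdx i0) (sndIdx i0), ?_, Or.inr (Equiv.Perm.sign_swap hne)⟩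
      have key : ∀ i : Fin k, Equiv.swap (fstIdx i0) (sndIdx i0) •
          ({fstIdx i, sndIdx i} : Set (Fin (2 * k))) = {fstIdx i, sndIdx i} := by
        intro i
        rw [← Set.image_smul, Set.image_pair]
        simp only [Equiv.Perm.smul_def]
        by_cases hi : i = i0
        · subst hi
          rw [Equiv.swap_apply_left, Equiv.swap_apply_right, Set.pair_comm]
        · have hv : i.val ≠ 0 := fun h => hi (Fin.ext h)
          rw [Equiv.swap_apply_of_ne_of_ne, Equiv.swap_apply_of_ne_of_ne] <;>
            simp only [fstIdx, sndIdx, i0, ne_eq, Fin.mk.injEq] <;> omega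
      rw [pairSubgroup, MulAction.mem_stabilizer_iff, stdPairs, ← Set.image_smul,
        ← Set.range_comp]
      exact congrArg Set.range (funext key)
  let f : Equiv.Perm (Fin (2 * k)) ⧸ pairSubgroup k → Equiv.Perm (Fin (2 * k)) := fun q =>
    if Equiv.Perm.sign q.out = 1 then q.out else q.out * τ
  have hf : ∀ q, (f q : Equiv.Perm (Fin (2 * k)) ⧸ pairSubgroup k) = q := by
    intro q
    by_cases h : Equiv.Perm.sign q.out = 1
    · simp [f, h]
    · simp only [f, h, if_false]
      rw [QuotientGroup.mk_mul_of_mem _ hτ]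
      exact q.out_eq
  refine ⟨(Set.toFinite (Set.range f)).toFinset, ?_, ?_⟩
  · rw [Set.Finite.coe_toFinset]
    exact Subgroup.isComplement_range_left hf
  · intro ν hν
    rw [Set.Finite.mem_toFinset] at hν
    obtain ⟨q, rfl⟩ := hν
    by_cases h : Equiv.Perm.sign q.out = 1
    · simp [f, h]
    · rcases hs with rfl | hs
      · exact absurd (by rw [show q.out = 1 from Equiv.ext fun i => Fin.elim0 i,
          Equiv.Perm.sign_one]) h
      · have h' := (Int.units_eq_one_or (Equiv.Perm.sign q.out)).resolve_left h
        simp [f, h', hs]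

variable {g : Type*} [LieRing g] [LieAlgebra ℂ g]

/-- `∑ ν ∈ N, [x (ν 0), x (ν 1)] ⋯ [x (ν (2 k - 2)), x (ν (2 k - 1))]`, in `P(g)`. -/
def matchingSum {k : ℕ} (N : Finset (Equiv.Perm (Fin (2 * k)))) (x : Fin (2 * k) → g) :
    SymmetricAlgebra ℂ g :=
  ∑ ν ∈ N, ∏ i : Fin k, SymmetricAlgebra.ι ℂ g ⁅x (ν (fstIdx i)), x (ν (sndIdx i))⁆

end Matchings

end KostantGamma

end

open scoped Pointwise

noncomputable section

namespace KostantGamma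

/-! ### Injectivity of symmetrization for Lie algebras acting by derivations -/

section Derivations

variable {A : Type*} [CommRing A] [Algebra ℂ A]

/-! In any associative algebra the signed sum of the products `x_σ(1) ⋯ x_σ(2k)` equals `2^{-k}`
times the signed sum of the products of the commutators of consecutive pairs, because interchanging
the members of a pair changes the sign. In `U(g)` the commutators are brackets. The corresponding
tensor `bracketTensor`, the signed sum of the `[x,x] ⊗ ⋯ ⊗ [x,x]`, is already symmetric, since
permuting whole pairs is an even permutation. Hence it is the symmetric tensor that defines `Γ`,
provided that `S(g) → U(g)` is injective. The summands in `P(g)` are constant on the left cosets of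
`Sym(2k,2)`, so `c_k = |Sym(2k,2)| / ((2k)! 2^k)`.

Injectivity (`ker_symToEnveloping_eq_bot`) follows from an action of `g` by derivations on a
commutative algebra with a point `ε` at which the derivations separate `g`. If a symmetric tensor
has the polynomial `p` of degree `N`, and `f` vanishes at `ε`, then its action on `f ^ N` has at `ε`
the value `N!` times the leading form of `p` at the differential of `f`. All differentials occur, so
a tensor that acts by zero is zero. For reductive `g` the coordinates are matrix coefficients of the
adjoint representation, which detect `g` modulo its center, and linear characters, which detect the
center.

For harmonicity, let `ξ_i` be anticommuting variables and `Ω = ∑ ξ_i ξ_j ⊗ [x_i, x_j]`. The top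
coefficient of `Ω^k` is a nonzero multiple of the matching sum, and `∂_p Ω^k` is a multiple of `p(Ω)
Ω^(k-j)` for `p` homogeneous of degree `j`. As in Chern–Weil theory, the Jacobi identity is a
Bianchi identity for `Ω`; with Euler's formula it gives `p(Ω) = 0` for invariant `p` of positive
degree (`curvatureEval_eq_zero`). -/

theorem derivation_mem_pow (I : Ideal A) (D : Derivation ℂ A A) (k : ℕ) {a : A}
    (h : a ∈ I ^ (k + 1)) : D a ∈ I ^ k := by
  induction k generalizing a with
  | zero => simp
  | succ k ih =>
    rw [pow_succ] at h
    refine Submodule.mul_induction_on h (fun x hx y hy => ?_) (fun x y hx hy => ?_)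
    · rw [D.leibniz]
      refine add_mem (Ideal.mul_mem_right _ _ hx) ?_
      rw [smul_eq_mul, mul_comm, pow_succ]
      exact Ideal.mul_mem_mul (ih hx) hy
    · rw [map_add]
      exact add_mem hx hy

/-- The main term arises when every derivation hits a new factor `f`; the descending factorial
counts the choices. Any other term keeps at least one more factor `f`. -/
theorem prod_derivations_pow_sub_mem (I : Ideal A) {f : A} (hf : f ∈ I) (n : ℕ)
    (ds : List (Derivation ℂ A A)) (hn : ds.length ≤ n) :
    (ds.map fun D : Derivation ℂ A A => (D : Module.End ℂ A)).prod (f ^ n)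
      - (n.descFactorial ds.length : A) * f ^ (n - ds.length) * (ds.map fun D => D f).prod
      ∈ I ^ (n - ds.length + 1) := by
  induction ds with
  | nil => simp
  | cons D ds ih =>
    rw [List.length_cons] at hn ⊢
    have hk : n - ds.length = (n - (ds.length + 1)) + 1 := by omega
    have h1 := ih (by omega)
    rw [hk] at h1
    generalize hK : n - (ds.length + 1) = K at h1 hk ⊢
    have h2 := derivation_mem_pow I D (K + 1) h1
    -- The term in which `D` hits the derivatives already produced and leaves the power of `f`
    -- untouched.
    have h3 : f ^ (K + 1) * ((n.descFactorial ds.length : A) * D (ds.map fun D => D f).prod)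
        ∈ I ^ (K + 1) := Ideal.mul_mem_right _ _ (Ideal.pow_mem_pow hf _)
    convert! add_mem h2 h3 using 1
    rw [List.map_cons, List.prod_cons, List.map_cons, List.prod_cons, map_sub,
      Nat.descFactorial_succ, hk, D.leibniz, D.leibniz, D.leibniz_pow, D.map_natCast]
    simp only [Module.End.mul_apply, smul_eq_mul, nsmul_eq_mul, Nat.cast_mul, Nat.add_sub_cancel]
    change D _ - _ = _
    ring

theorem eval_prod_derivations_pow (ε : A →ₐ[ℂ] ℂ) {f : A} (hf : ε f = 0) (n : ℕ)
    (ds : List (Derivation ℂ A A)) (hn : ds.length ≤ n) :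
    ε ((ds.map fun D : Derivation ℂ A A => (D : Module.End ℂ A)).prod (f ^ n)) =
      if ds.length = n then (n.factorial : ℂ) * (ds.map fun D => ε (D f)).prod else 0 := by
  have h := prod_derivations_pow_sub_mem (RingHom.ker ε) (f := f) hf n ds hn
  have h' := Ideal.pow_le_self (by omega) h
  rw [RingHom.mem_ker, map_sub, sub_eq_zero] at h'
  rw [h']
  split_ifs with hl
  · rw [hl, Nat.descFactorial_self, Nat.sub_self, pow_zero, mul_one, map_mul, map_natCast,
      map_list_prod, List.map_map]
    rfl
  · rw [map_mul, map_mul, map_pow, hf, zero_pow (by omega), mul_zero, zero_mul]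

end Derivations

/-! ### Symmetric tensors and polynomials -/

section SymmetricTensors

variable {V κ : Type*} [AddCommGroup V] [Module ℂ V]

/-- The symmetrization of a tensor monomial. -/
def symmetrized {n : ℕ} (x : Fin n → V) : TensorAlgebra ℂ V :=
  ∑ σ : Equiv.Perm (Fin n), TensorAlgebra.tprod ℂ V n (fun i => x (σ i))

theorem symmetrized_comp_perm {n : ℕ} (x : Fin n → V) (σ : Equiv.Perm (Fin n)) :
    symmetrized (x ∘ σ) = symmetrized x :=
  Equiv.sum_comp (Equiv.mulLeft σ) fun τ => TensorAlgebra.tprod ℂ V n (fun i => x (τ i))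

/-- The exponent of the monomial `∏ X (w i)`. -/
def wordExponent {n : ℕ} (w : Fin n → κ) : κ →₀ ℕ := ∑ i, Finsupp.single (w i) 1

theorem wordExponent_degree {n : ℕ} (w : Fin n → κ) : (wordExponent w).degree = n := by
  simp [wordExponent]

theorem wordExponent_apply {n : ℕ} (w : Fin n → κ) (a : κ) :
    wordExponent w a = Nat.card {i // w i = a} := by
  classical
  simp [wordExponent, Finsupp.finsetSum_apply, Finsupp.single_apply, Fintype.card_subtype]

theorem exists_perm_of_wordExponent_eq {n : ℕ} {w w' : Fin n → κ}
    (h : wordExponent w = wordExponent w') : ∃ σ : Equiv.Perm (Fin n), w = w' ∘ σ := by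
  have e (a : κ) : Nonempty ({i // w i = a} ≃ {i // w' i = a}) :=
    Finite.card_eq.1 (by rw [← wordExponent_apply, ← wordExponent_apply, h])
  refine ⟨Equiv.ofFiberEquiv fun a => (e a).some, ?_⟩
  ext i
  exact (Equiv.ofFiberEquiv_map _ i).symm

theorem monomial_wordExponent {n : ℕ} (w : Fin n → κ) :
    MvPolynomial.monomial (wordExponent w) (1 : ℂ) = ∏ i, MvPolynomial.X (w i) := by
  rw [wordExponent, MvPolynomial.monomial_sum_one]
  rfl

theorem exists_wordExponent_eq (m : κ →₀ ℕ) : ∃ (n : ℕ) (w : Fin n → κ), wordExponent w = m := by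
  induction m using Finsupp.induction_linear with
  | zero => exact ⟨0, Fin.elim0, by simp [wordExponent]⟩
  | add f g hf hg =>
    obtain ⟨n, w, rfl⟩ := hf
    obtain ⟨n', w', rfl⟩ := hg
    exact ⟨n + n', Fin.append w w', by simp [wordExponent, Fin.sum_univ_add]⟩
  | single a n => exact ⟨n, fun _ => a, by simp [wordExponent]⟩

variable (b : Module.Basis κ ℂ V)

/-- Words with the same exponent have the same length and differ by a permutation, which
symmetrization does not see. This makes symmetrization well defined on monomials. -/
theorem exists_symmetrization_monomial (m : κ →₀ ℕ) : ∃ t : TensorAlgebra ℂ V,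
    ∀ (n : ℕ) (w : Fin n → κ), wordExponent w = m →
      symmetrized (b ∘ w) = (n.factorial : ℂ) • t := by
  obtain ⟨n, w, rfl⟩ := exists_wordExponent_eq m
  refine ⟨(n.factorial : ℂ)⁻¹ • symmetrized (b ∘ w), fun n' w' h => ?_⟩
  obtain rfl : n' = n := by rw [← wordExponent_degree w', h, wordExponent_degree]
  obtain ⟨σ, rfl⟩ := exists_perm_of_wordExponent_eq h
  rw [← Function.comp_assoc, symmetrized_comp_perm, smul_smul,
    mul_inv_cancel₀ (Nat.cast_ne_zero.2 n'.factorial_ne_zero), one_smul]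

/-- The symmetrization map from polynomials to tensors. -/
def symmetrization : MvPolynomial κ ℂ →ₗ[ℂ] TensorAlgebra ℂ V :=
  (MvPolynomial.basisMonomials κ ℂ).constr ℂ fun m => (exists_symmetrization_monomial b m).choose

theorem factorial_smul_symmetrization {n : ℕ} (w : Fin n → κ) :
    (n.factorial : ℂ) • symmetrization b (MvPolynomial.monomial (wordExponent w) 1) =
      symmetrized (b ∘ w) := by
  have h : symmetrization b (MvPolynomial.monomial (wordExponent w) 1) =
      (exists_symmetrization_monomial b (wordExponent w)).choose := by
    have := Module.Basis.constr_basis (MvPolynomial.basisMonomials κ ℂ) ℂ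
      (fun m => (exists_symmetrization_monomial b m).choose) (wordExponent w)
    rwa [MvPolynomial.coe_basisMonomials] at this
  rw [h, (exists_symmetrization_monomial b _).choose_spec n w rfl]

theorem symmetrized_mem_span_basis [Fintype κ] {n : ℕ} (x : Fin n → V) :
    symmetrized x ∈
      Submodule.span ℂ (Set.range fun w : Fin n → κ => symmetrized (b ∘ w)) := by
  classical
  let M : MultilinearMap ℂ (fun _ : Fin n => V) (TensorAlgebra ℂ V) :=
    ∑ σ : Equiv.Perm (Fin n), (TensorAlgebra.tprod ℂ V n).domDomCongr σ
  have hM (y : Fin n → V) : symmetrized y = M y := by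
    simp [M, symmetrized]
  have hx : x = fun i => ∑ j, b.repr (x i) j • b j := funext fun i => (b.sum_repr (x i)).symm
  rw [hM, hx, M.map_sum]
  refine sum_mem fun r _ => ?_
  rw [M.map_smul_univ fun i => b.repr (x i) (r i)]
  refine Submodule.smul_mem _ _ (Submodule.subset_span ⟨r, ?_⟩)
  exact hM _

/-- The projection of tensors to polynomials in the coordinates. -/
def toPolynomial : TensorAlgebra ℂ V →ₐ[ℂ] MvPolynomial κ ℂ :=
  (SymmetricAlgebra.equivMvPolynomial b : SymmetricAlgebra ℂ V →ₐ[ℂ] MvPolynomial κ ℂ).comp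
    (SymmetricAlgebra.algHom ℂ V)

theorem toPolynomial_symmetrized {n : ℕ} (w : Fin n → κ) :
    toPolynomial b (symmetrized (b ∘ w)) =
      (n.factorial : ℂ) • MvPolynomial.monomial (wordExponent w) 1 := by
  have h (σ : Equiv.Perm (Fin n)) : toPolynomial b
      (TensorAlgebra.tprod ℂ V n (fun i => (b ∘ w) (σ i))) =
        MvPolynomial.monomial (wordExponent w) 1 := by
    have h' (i : κ) : toPolynomial b (TensorAlgebra.ι ℂ (b i)) = MvPolynomial.X i :=
      SymmetricAlgebra.equivMvPolynomial_ι_apply b i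
    rw [TensorAlgebra.tprod_apply, map_list_prod, List.map_ofFn, List.prod_ofFn,
      monomial_wordExponent]
    exact (Finset.prod_congr rfl fun i _ => h' (w (σ i))).trans
      (Equiv.prod_comp σ fun i => MvPolynomial.X (w i))
  rw [symmetrized, map_sum, Finset.sum_congr rfl fun σ _ => h σ]
  simp [Fintype.card_perm, ← Nat.cast_smul_eq_nsmul ℂ]

/-- By multilinearity it suffices to treat words in the basis, where the two factors `n!` match.
Thus a symmetric tensor is determined by its polynomial. -/
theorem symmetrization_toPolynomial_symmetrized [Fintype κ] {n : ℕ} (x : Fin n → V) :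
    symmetrization b (toPolynomial b (symmetrized x)) = symmetrized x := by
  refine Submodule.span_induction (p := fun t _ => symmetrization b (toPolynomial b t) = t)
    ?_ ?_ ?_ ?_ (symmetrized_mem_span_basis b x)
  · rintro _ ⟨w, rfl⟩
    rw [toPolynomial_symmetrized, map_smul, factorial_smul_symmetrization]
  · simp
  · intro s t _ _ hs ht
    rw [map_add, map_add, hs, ht]
  · intro c t _ ht
    rw [map_smul, map_smul, ht]

end SymmetricTensors

/-! ### Injectivity from an action that separates the Lie algebra at a point -/

section Criterion

variable {g A : Type*} [LieRing g] [LieAlgebra ℂ g] [CommRing A] [Algebra ℂ A]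

attribute [local instance] LieRing.ofAssociativeRing in
/-- A Lie algebra action by derivations extends to the enveloping algebra. -/
theorem exists_envelopingAction (D : g →ₗ⁅ℂ⁆ Derivation ℂ A A) :
    ∃ Φ : UniversalEnvelopingAlgebra ℂ g →ₐ[ℂ] Module.End ℂ A, ∀ x,
      Φ (UniversalEnvelopingAlgebra.mkAlgHom ℂ g (TensorAlgebra.ι ℂ x)) =
        (D x : A →ₗ[ℂ] A) := by
  let D' : g →ₗ⁅ℂ⁆ Module.End ℂ A :=
    { toFun x := (D x : A →ₗ[ℂ] A)
      map_add' x y := by rw [map_add]; rfl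
      map_smul' c x := by rw [map_smul]; rfl
      map_lie' {x y} := by rw [LieHom.map_lie]; rfl }
  exact ⟨UniversalEnvelopingAlgebra.lift ℂ D', fun x =>
    UniversalEnvelopingAlgebra.lift_ι_apply ℂ D' x⟩

theorem homogeneousComponent_totalDegree_ne_zero {κ : Type*} {p : MvPolynomial κ ℂ} (hp : p ≠ 0) :
    MvPolynomial.homogeneousComponent p.totalDegree p ≠ 0 := by
  obtain ⟨m, hm, h⟩ := Finset.exists_mem_eq_sup p.support (MvPolynomial.support_nonempty.2 hp)
    fun s => s.sum fun _ e => e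
  intro h0
  have h1 := congrArg (MvPolynomial.coeff m) h0
  rw [MvPolynomial.coeff_homogeneousComponent, if_pos, MvPolynomial.coeff_zero] at h1
  · exact MvPolynomial.mem_support_iff.1 hm h1
  · exact h.symm

variable {κ : Type*} [Fintype κ] (b : Module.Basis κ ℂ g)

/-- A monomial of degree less than `N` leaves a factor `f`, which vanishes at `ε`; one of degree `N`
contributes `N!` times a product of first derivatives, whatever the order of its factors. -/
theorem eval_symmetrization_action (D : g →ₗ⁅ℂ⁆ Derivation ℂ A A) (ε : A →ₐ[ℂ] ℂ)
    {Φ : UniversalEnvelopingAlgebra ℂ g →ₐ[ℂ] Module.End ℂ A}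
    (hΦ : ∀ x, Φ (UniversalEnvelopingAlgebra.mkAlgHom ℂ g (TensorAlgebra.ι ℂ x)) =
      (D x : A →ₗ[ℂ] A)) {f : A} (hf : ε f = 0) (p : MvPolynomial κ ℂ) :
    ε (Φ (UniversalEnvelopingAlgebra.mkAlgHom ℂ g (symmetrization b p)) (f ^ p.totalDegree)) =
      (p.totalDegree.factorial : ℂ) * MvPolynomial.eval (fun i => ε (D (b i) f))
        (MvPolynomial.homogeneousComponent p.totalDegree p) := by
  generalize hN : p.totalDegree = N
  have hmon (m : κ →₀ ℕ) (hm : m.degree ≤ N) :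
      ε (Φ (UniversalEnvelopingAlgebra.mkAlgHom ℂ g
        (symmetrization b (MvPolynomial.monomial m 1))) (f ^ N)) =
        if m.degree = N then (N.factorial : ℂ) *
          MvPolynomial.eval (fun i => ε (D (b i) f)) (MvPolynomial.monomial m 1) else 0 := by
    obtain ⟨n, w, rfl⟩ := exists_wordExponent_eq m
    rw [wordExponent_degree] at hm ⊢
    have hfac : (n.factorial : ℂ) ≠ 0 := Nat.cast_ne_zero.2 n.factorial_ne_zero
    have hs (σ : Equiv.Perm (Fin n)) :
        ε (Φ (UniversalEnvelopingAlgebra.mkAlgHom ℂ g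
          (TensorAlgebra.tprod ℂ g n fun i => (b ∘ w) (σ i))) (f ^ N)) =
        if n = N then (N.factorial : ℂ) *
          MvPolynomial.eval (fun i => ε (D (b i) f))
            (MvPolynomial.monomial (wordExponent w) 1) else 0 := by
      have h := eval_prod_derivations_pow ε hf N (List.ofFn fun i => D (b (w (σ i))))
        (by simpa using hm)
      rw [List.map_ofFn, List.map_ofFn, List.length_ofFn] at h
      rw [TensorAlgebra.tprod_apply, map_list_prod, map_list_prod, List.map_ofFn, List.map_ofFn,
        monomial_wordExponent, map_prod]
      simp only [MvPolynomial.eval_X]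
      rw [List.prod_ofFn] at h
      rw [← Equiv.prod_comp σ]
      simp only [Function.comp_def, hΦ]
      exact h
    -- The symmetrization of a monomial is known explicitly only after multiplication by `n!`.
    apply mul_left_cancel₀ hfac
    rw [← smul_eq_mul, ← map_smul, ← LinearMap.smul_apply, ← map_smul, ← map_smul,
      factorial_smul_symmetrization, symmetrized]
    simp only [map_sum, LinearMap.sum_apply, hs]
    simp [Fintype.card_perm]
  have hp : p = ∑ m ∈ p.support, p.coeff m • MvPolynomial.monomial m 1 := by
    conv_lhs => rw [p.as_sum]
    simp [MvPolynomial.smul_monomial]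
  have hl : ε (Φ (UniversalEnvelopingAlgebra.mkAlgHom ℂ g (symmetrization b p)) (f ^ N)) =
      ∑ m ∈ p.support, p.coeff m * ε (Φ (UniversalEnvelopingAlgebra.mkAlgHom ℂ g
        (symmetrization b (MvPolynomial.monomial m 1))) (f ^ N)) := by
    conv_lhs => rw [hp]
    simp only [map_sum, map_smul, LinearMap.sum_apply, LinearMap.smul_apply, smul_eq_mul]
  rw [hl, MvPolynomial.homogeneousComponent_apply, map_sum, Finset.mul_sum, Finset.sum_filter]
  refine Finset.sum_congr rfl fun m hm => ?_
  rw [hmon m (hN ▸ MvPolynomial.le_totalDegree hm)]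
  split_ifs
  · simp [MvPolynomial.eval_monomial]
    ring
  · simp

/-- The differentials at `ε` form a subspace of the dual of `g` with zero annihilator in `g`, hence
the whole dual. -/
theorem exists_eval_derivation_eq [FiniteDimensional ℂ g]
    (D : g →ₗ⁅ℂ⁆ Derivation ℂ A A) (ε : A →ₐ[ℂ] ℂ)
    (h : ∀ x, (∀ f, ε (D x f) = 0) → x = 0) (φ : Module.Dual ℂ g) :
    ∃ f, ε f = 0 ∧ ∀ x, ε (D x f) = φ x := by
  let ψ : A →ₗ[ℂ] Module.Dual ℂ g :=
    { toFun f := { toFun x := ε (D x f)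
                   map_add' x y := by simp
                   map_smul' c x := by simp }
      map_add' f f' := by ext; simp
      map_smul' c f := by ext; simp }
  have hψ : LinearMap.range ψ = ⊤ := by
    have h0 : (LinearMap.range ψ).dualCoannihilator = ⊥ :=
      (Submodule.eq_bot_iff _).2 fun x hx => h x fun f =>
        (Submodule.mem_dualCoannihilator _).1 hx _ ⟨f, rfl⟩
    rw [← Subspace.dualCoannihilator_dualAnnihilator_eq (W := LinearMap.range ψ), h0,
      Submodule.dualAnnihilator_bot]
  obtain ⟨f, hf⟩ := LinearMap.range_eq_top.1 hψ φ
  -- Derivations kill constants, so `f` may be normalized to vanish at `ε`.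
  refine ⟨f - algebraMap ℂ A (ε f), by simp, fun x => ?_⟩
  rw [← hf, map_sub, Derivation.map_algebraMap, sub_zero]
  rfl

theorem ker_symToEnveloping_eq_bot [FiniteDimensional ℂ g]
    (D : g →ₗ⁅ℂ⁆ Derivation ℂ A A) (ε : A →ₐ[ℂ] ℂ)
    (h : ∀ x, (∀ f, ε (D x f) = 0) → x = 0) : LinearMap.ker (symToEnveloping g) = ⊥ := by
  obtain ⟨Φ, hΦ⟩ := exists_envelopingAction D
  let b := Module.finBasis ℂ g
  rw [LinearMap.ker_eq_bot']
  rintro ⟨t, ht⟩ h0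
  replace h0 : UniversalEnvelopingAlgebra.mkAlgHom ℂ g t = 0 := h0
  have hs : symmetrization b (toPolynomial b t) = t := by
    refine Submodule.span_induction (p := fun t _ => symmetrization b (toPolynomial b t) = t)
      ?_ ?_ ?_ ?_ ht
    · rintro _ ⟨n, x, rfl⟩
      exact symmetrization_toPolynomial_symmetrized b x
    · simp
    · intro s t _ _ hs ht
      rw [map_add, map_add, hs, ht]
    · intro c t _ ht
      rw [map_smul, map_smul, ht]
  have hp : toPolynomial b t = 0 := by
    by_contra hp
    -- The leading form is shown to vanish at every point `v`, by realizing `v` as the differential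
    -- of some `f`.
    refine homogeneousComponent_totalDegree_ne_zero hp (MvPolynomial.funext fun v => ?_)
    obtain ⟨f, hf, hv⟩ := exists_eval_derivation_eq D ε h (b.constr ℂ v)
    have := eval_symmetrization_action b D ε hΦ hf (toPolynomial b t)
    rw [hs, h0, map_zero, LinearMap.zero_apply, map_zero, zero_eq_mul] at this
    have h1 := this.resolve_left (Nat.cast_ne_zero.2 (Nat.factorial_ne_zero _))
    simp only [hv, Module.Basis.constr_basis] at h1
    rw [h1, map_zero]
  rw [Submodule.mk_eq_zero, ← hs, hp, map_zero]

end Criterion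

/-! ### Reductive Lie algebras -/

section Cocycles

variable {s : Type*} [LieRing s] [LieAlgebra ℂ s] [FiniteDimensional ℂ s]
  [LieAlgebra.IsKilling ℂ s]

/-- A bilinear form that satisfies the cocycle identity is a coboundary. -/
theorem exists_killingForm_lie_eq (β : LinearMap.BilinForm ℂ s)
    (hβ : ∀ x y z, β ⁅x, y⁆ z = β x ⁅y, z⁆ - β y ⁅x, z⁆) :
    ∃ u, ∀ x y, β x y = killingForm ℂ s u ⁅x, y⁆ := by
  have hnd := LieAlgebra.IsKilling.killingForm_nondegenerate ℂ s
  -- Through the Killing form `β` becomes an endomorphism; the cocycle identity says that it is a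
  -- derivation, hence inner, and `u` implements it.
  let D : s →ₗ[ℂ] s := ((killingForm ℂ s).toDual hnd).symm ∘ₗ β
  have hD (x y : s) : killingForm ℂ s (D x) y = β x y :=
    LinearMap.BilinForm.apply_toDual_symm_apply (hB := hnd) _ _
  have hinv (x y z : s) : killingForm ℂ s ⁅x, y⁆ z = killingForm ℂ s x ⁅y, z⁆ :=
    LieModule.traceForm_apply_lie_apply ℂ s s x y z
  let D' : LieDerivation ℂ s s :=
    { D with
      leibniz' := fun x y => by
        change D _ = ⁅x, D y⁆ - ⁅y, D x⁆
        rw [← sub_eq_zero]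
        refine hnd.1 _ fun z => ?_
        rw [← lie_skew x (D y), ← lie_skew y (D x)]
        simp only [map_sub, map_neg, LinearMap.sub_apply, LinearMap.neg_apply, hinv, hD, hβ]
        ring }
  obtain ⟨u, hu⟩ := LieDerivation.IsKilling.exists_eq_ad D'
  refine ⟨u, fun x y => ?_⟩
  have hux : ⁅u, x⁆ = D x :=
    (LieDerivation.ad_apply_apply ℂ s u x).symm.trans (DFunLike.congr_fun hu x)
  rw [← hD, ← hinv, hux]

end Cocycles

section Reductive

variable {g : Type*} [LieRing g] [LieAlgebra ℂ g]

/-- The preimage `J` of an abelian ideal has `[J, J]` central, so `J` is solvable and lies in the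
radical, which is the center. -/
theorem hasTrivialRadical_quotient_center [FiniteDimensional ℂ g] (hg : IsReductive g) :
    LieAlgebra.HasTrivialRadical ℂ (g ⧸ LieAlgebra.center ℂ g) := by
  rw [LieAlgebra.hasTrivialRadical_iff_no_abelian_ideals]
  intro I hI
  let π := LieSubmodule.Quotient.mk' (LieAlgebra.center ℂ g)
  have hlie (x y : g) : π ⁅x, y⁆ = ⁅π x, π y⁆ := rfl
  let J : LieIdeal ℂ g :=
    { Submodule.comap (π : g →ₗ[ℂ] g ⧸ LieAlgebra.center ℂ g) I.toSubmodule with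
      lie_mem := fun {x y} (hy : π y ∈ I) => by
        change π _ ∈ I
        rw [hlie]
        exact lie_mem_right ℂ _ I _ _ hy }
  have hmem (x : g) : x ∈ J ↔ π x ∈ I := Iff.rfl
  have h1 : ⁅J, J⁆ ≤ LieAlgebra.center ℂ g := by
    rw [LieSubmodule.lie_le_iff]
    intro x hx y hy
    rw [← LieSubmodule.Quotient.mk_eq_zero, hlie]
    exact congrArg Subtype.val (hI.trivial ⟨π x, hx⟩ ⟨π y, hy⟩)
  have h2 : ⁅⁅J, J⁆, ⁅J, J⁆⁆ = ⊥ := by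
    rw [eq_bot_iff, LieSubmodule.lie_le_iff]
    intro x _ y hy
    exact h1 hy x
  have hJ : LieAlgebra.IsSolvable J := by
    refine LieAlgebra.IsSolvable.mk (R := ℂ) (k := 2) ?_
    rw [LieIdeal.derivedSeries_eq_bot_iff]
    exact h2
  have hJ' : J ≤ LieAlgebra.center ℂ g :=
    hg ▸ (LieAlgebra.LieIdeal.solvable_iff_le_radical ℂ g J).1 hJ
  rw [eq_bot_iff]
  intro a ha
  obtain ⟨x, rfl⟩ := LieSubmodule.Quotient.surjective_mk' _ a
  exact (LieSubmodule.Quotient.mk_eq_zero _).2 (hJ' ha)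

/-- Take any functional `l` with `l c ≠ 0`. Since brackets depend only on classes modulo the center,
`l` of the bracket is a cocycle on the semisimple quotient, hence a coboundary. Subtracting the
corresponding functional of the quotient makes `l` vanish on brackets and does not change its value
at `c`. -/
theorem exists_functional_of_mem_center [FiniteDimensional ℂ g] (hg : IsReductive g) {c : g}
    (hc : c ∈ LieAlgebra.center ℂ g) (hc0 : c ≠ 0) :
    ∃ μ : Module.Dual ℂ g, (∀ x y : g, μ ⁅x, y⁆ = 0) ∧ μ c ≠ 0 := by
  have := hasTrivialRadical_quotient_center hg
  let π : g →ₗ[ℂ] g ⧸ LieAlgebra.center ℂ g := LieSubmodule.Quotient.mk' (LieAlgebra.center ℂ g)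
  have hlie (x y : g) : π ⁅x, y⁆ = ⁅π x, π y⁆ := rfl
  have hker (x : g) : π x = 0 ↔ ∀ y, ⁅y, x⁆ = 0 :=
    LieSubmodule.Quotient.mk_eq_zero _
  obtain ⟨σ, hσ⟩ := π.exists_rightInverse_of_surjective
    (LinearMap.range_eq_top.2 (LieSubmodule.Quotient.surjective_mk' _))
  replace hσ (a) : π (σ a) = a := LinearMap.congr_fun hσ a
  have hl (x y : g) : ⁅x, σ (π y)⁆ = ⁅x, y⁆ := by
    rw [← sub_eq_zero, ← lie_sub]
    exact (hker _).1 (by rw [map_sub, hσ, sub_self]) x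
  have hr (x y : g) : ⁅σ (π x), y⁆ = ⁅x, y⁆ := by
    rw [← lie_skew, hl, lie_skew]
  have hσl (a b) : ∀ x, ⁅x, σ ⁅a, b⁆⁆ = ⁅x, ⁅σ a, σ b⁆⁆ := fun x => by
    rw [← hl x ⁅σ a, σ b⁆, hlie, hσ, hσ]
  obtain ⟨l, hlc⟩ : ∃ l : Module.Dual ℂ g, l c ≠ 0 := by
    by_contra! h
    exact hc0 ((Module.forall_dual_apply_eq_zero_iff ℂ c).1 h)
  let β : LinearMap.BilinForm ℂ (g ⧸ LieAlgebra.center ℂ g) :=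
    LinearMap.mk₂ ℂ (fun a b => l ⁅σ a, σ b⁆) (by simp) (by simp) (by simp) (by simp)
  obtain ⟨u, hu⟩ := exists_killingForm_lie_eq β fun a b e => by
    simp only [β, LinearMap.mk₂_apply, hσl]
    rw [← lie_skew, hσl, lie_skew, ← map_sub, lie_lie]
  refine ⟨l - killingForm ℂ _ u ∘ₗ π, fun x y => ?_, ?_⟩
  · have := hu (π x) (π y)
    simp only [β, LinearMap.mk₂_apply, hl, hr] at this
    simp [this, hlie]
  · have : π c = 0 := (LieSubmodule.Quotient.mk_eq_zero _).2 hc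
    simpa [this] using hlc

/-- The functionals that vanish on the derived algebra. -/
def characters (g : Type*) [LieRing g] [LieAlgebra ℂ g] : Submodule ℂ (Module.Dual ℂ g) where
  carrier := {μ | ∀ x y : g, μ ⁅x, y⁆ = 0}
  add_mem' h h' x y := by simp [h x y, h' x y]
  zero_mem' x y := rfl
  smul_mem' c μ h x y := by simp [h x y]

/-- The vector field of `x` in coordinates that consist of the matrix coefficients of the adjoint
representation and of the characters. -/
def coordinateAction (x : g) :
    Module.End ℂ g × characters g →ₗ[ℂ] SymmetricAlgebra ℂ (Module.End ℂ g × characters g) :=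
  SymmetricAlgebra.ι ℂ _ ∘ₗ LinearMap.inl ℂ _ _ ∘ₗ
      LinearMap.mulLeft ℂ (LieAlgebra.ad ℂ g x : Module.End ℂ g) ∘ₗ LinearMap.fst ℂ _ _ +
    Algebra.linearMap ℂ _ ∘ₗ LinearMap.applyₗ x ∘ₗ (characters g).subtype ∘ₗ LinearMap.snd ℂ _ _

theorem coordinateAction_apply (x : g) (w : Module.End ℂ g × characters g) :
    coordinateAction x w = SymmetricAlgebra.ι ℂ _ ((LieAlgebra.ad ℂ g x : Module.End ℂ g) * w.1, 0)
      + algebraMap ℂ _ (w.2.1 x) := rfl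

/-- The action of a Lie algebra by derivations of the algebra of coordinates. -/
def coordinateDerivation : g →ₗ⁅ℂ⁆ Derivation ℂ
    (SymmetricAlgebra ℂ (Module.End ℂ g × characters g))
    (SymmetricAlgebra ℂ (Module.End ℂ g × characters g)) where
  toFun x := deriv (coordinateAction x)
  map_add' x y := derivation_ext fun w => by
    have : ((LieAlgebra.ad ℂ g (x + y) : Module.End ℂ g) * w.1, (0 : characters g)) =
        ((LieAlgebra.ad ℂ g x : Module.End ℂ g) * w.1, 0) +
          ((LieAlgebra.ad ℂ g y : Module.End ℂ g) * w.1, 0) := by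
      simp [add_mul]
    simp only [Derivation.add_apply, deriv_ι, coordinateAction_apply]
    rw [this, map_add, map_add, map_add]
    abel
  map_smul' c x := derivation_ext fun w => by
    have : ((LieAlgebra.ad ℂ g (c • x) : Module.End ℂ g) * w.1, (0 : characters g)) =
        c • ((LieAlgebra.ad ℂ g x : Module.End ℂ g) * w.1, 0) := by
      simp
    simp only [Derivation.smul_apply, deriv_ι, coordinateAction_apply, RingHom.id_apply]
    rw [this, map_smul, map_smul, smul_eq_mul, map_mul, smul_add,
      Algebra.smul_def c (algebraMap _ _ _)]
  map_lie' {x y} := derivation_ext fun w => by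
    have : ((LieAlgebra.ad ℂ g ⁅x, y⁆ : Module.End ℂ g) * w.1, (0 : characters g)) =
        ((LieAlgebra.ad ℂ g x : Module.End ℂ g) * ((LieAlgebra.ad ℂ g y : Module.End ℂ g) * w.1), 0)
          - ((LieAlgebra.ad ℂ g y : Module.End ℂ g) *
            ((LieAlgebra.ad ℂ g x : Module.End ℂ g) * w.1), 0) := by
      simp [LieRing.of_associative_ring_bracket, sub_mul, mul_assoc]
    -- The commutator of two derivations kills the character coordinates, as their first derivatives
    -- are constants; so characters must vanish on brackets.
    have hw : w.2.1 ⁅x, y⁆ = 0 := w.2.2 x y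
    rw [deriv_ι, coordinateAction_apply, this, hw, map_sub]
    simp [Derivation.commutator_apply, deriv_ι, coordinateAction_apply]

/-- Evaluation of the coordinates at the identity. -/
def coordinateEval (g : Type*) [LieRing g] [LieAlgebra ℂ g] :
    SymmetricAlgebra ℂ (Module.End ℂ g × characters g) →ₐ[ℂ] ℂ :=
  SymmetricAlgebra.lift (LinearMap.trace ℂ g ∘ₗ LinearMap.fst ℂ _ _)

theorem ker_symToEnveloping [FiniteDimensional ℂ g] (hg : IsReductive g) :
    LinearMap.ker (symToEnveloping g) = ⊥ := by
  refine ker_symToEnveloping_eq_bot coordinateDerivation (coordinateEval g) fun x hx => ?_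
  have key (w : Module.End ℂ g × characters g) :
      LinearMap.trace ℂ g ((LieAlgebra.ad ℂ g x : Module.End ℂ g) * w.1) + w.2.1 x = 0 := by
    have := hx (SymmetricAlgebra.ι ℂ _ w)
    change coordinateEval g (deriv _ _) = 0 at this
    rw [deriv_ι, coordinateAction_apply, map_add, AlgHom.commutes, coordinateEval,
      SymmetricAlgebra.lift_ι_apply] at this
    exact this
  have hc : x ∈ LieAlgebra.center ℂ g := by
    intro y
    rw [← lie_skew, neg_eq_zero, ← Module.forall_dual_apply_eq_zero_iff ℂ]
    intro φ
    -- Testing against rank one endomorphisms turns the trace condition into `φ [x, y] = 0` for all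
    -- `φ`, so `x` is central.
    have h : (LieAlgebra.ad ℂ g x : Module.End ℂ g) * φ.smulRight y = φ.smulRight ⁅x, y⁆ := by
      ext z
      simp
    have := key (φ.smulRight y, 0)
    rw [h] at this
    simpa using this
  by_contra h0
  obtain ⟨μ, hμ, hμx⟩ := exists_functional_of_mem_center hg hc h0
  exact hμx (by simpa using key (0, ⟨μ, hμ⟩))

end Reductive

/-! ### Alternating sums by means of Grassmann variables -/

section Grassmann

open scoped TensorProduct

/-- The Grassmann algebra in `n` variables. -/
abbrev Grassmann (n : ℕ) : Type := ExteriorAlgebra ℂ (Fin n → ℂ)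

/-- The generators of the Grassmann algebra. -/
def oddVar {n : ℕ} (i : Fin n) : Grassmann n := ExteriorAlgebra.ι ℂ (Pi.single i 1)

theorem oddVar_mul_oddVar {n : ℕ} (i j : Fin n) : oddVar i * oddVar j = -(oddVar j * oddVar i) :=
  eq_neg_of_add_eq_zero_left (ExteriorAlgebra.ι_add_mul_swap _ _)

/-- The coefficient of the product of all the generators. -/
def topCoeff (n : ℕ) : Grassmann n →ₗ[ℂ] ℂ :=
  ExteriorAlgebra.liftAlternating (Pi.single n Matrix.detRowAlternating)

theorem topCoeff_prod {n : ℕ} (f : Fin n → Fin n) :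
    topCoeff n (List.ofFn fun i => oddVar (f i)).prod =
      Matrix.detRowAlternating (fun i => (Pi.single (f i) 1 : Fin n → ℂ)) := by
  have h := ExteriorAlgebra.ιMulti_apply (R := ℂ) (fun i => (Pi.single (f i) 1 : Fin n → ℂ))
  change topCoeff n (List.ofFn fun i => ExteriorAlgebra.ι ℂ (Pi.single (f i) 1)).prod = _
  rw [← h, topCoeff, ExteriorAlgebra.liftAlternating_apply_ιMulti, Pi.single_eq_same]

theorem topCoeff_prod_of_not_injective {n : ℕ} {f : Fin n → Fin n} (hf : ¬ Function.Injective f) :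
    topCoeff n (List.ofFn fun i => oddVar (f i)).prod = 0 := by
  rw [topCoeff_prod]
  refine AlternatingMap.map_eq_zero_of_not_injective _ _ fun h => hf fun i j hij => h ?_
  simp only [hij]

theorem topCoeff_prod_perm {n : ℕ} (σ : Equiv.Perm (Fin n)) :
    topCoeff n (List.ofFn fun i => oddVar (σ i)).prod = Equiv.Perm.sign σ := by
  rw [topCoeff_prod]
  have h := AlternatingMap.map_perm (Matrix.detRowAlternating (n := Fin n) (R := ℂ))
    (fun i => (Pi.single i 1 : Fin n → ℂ)) σ
  have h1 : Matrix.detRowAlternating (fun i => (Pi.single i 1 : Fin n → ℂ)) = 1 := by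
    refine (congrArg Matrix.det ?_).trans (Matrix.det_one (n := Fin n))
    ext i j
    rw [Matrix.one_apply, Pi.single_apply]
    simp only [eq_comm]
  rw [h1] at h
  refine h.trans ?_
  rw [Units.smul_def, zsmul_eq_mul, mul_one]

/-- A sequence of pairs is a sequence of twice the length. -/
def pairingEquiv (k : ℕ) (α : Type*) : (Fin (2 * k) → α) ≃ (Fin k → α × α) where
  toFun f i := (f (fstIdx i), f (sndIdx i))
  invFun F j := if j.val % 2 = 0 then (F ⟨j / 2, by omega⟩).1 else (F ⟨j / 2, by omega⟩).2
  left_inv f := by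
    funext j
    dsimp only
    split_ifs with h
    · exact congrArg f (Fin.ext (by simp only [fstIdx]; omega))
    · exact congrArg f (Fin.ext (by simp only [sndIdx]; omega))
  right_inv F := by
    funext i
    have h1 : (2 * i.val + 1) / 2 = i := by omega
    simp [fstIdx, sndIdx, h1, Nat.add_mod]

theorem prod_ofFn_pairs {M : Type*} [Monoid M] {k : ℕ} (f : Fin (2 * k) → M) :
    (List.ofFn fun i : Fin k => f (fstIdx i) * f (sndIdx i)).prod = (List.ofFn f).prod := by
  rw [List.ofFn_mul', List.prod_flatten, List.map_ofFn]
  congr 2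
  funext i
  simp [fstIdx, sndIdx]

variable {A : Type*} [Ring A] [Algebra ℂ A]

theorem prod_ofFn_tmul {B : Type*} [Ring B] [Algebra ℂ B] {k : ℕ} (a : Fin k → B) (b : Fin k → A) :
    (List.ofFn fun i => a i ⊗ₜ[ℂ] b i).prod = (List.ofFn a).prod ⊗ₜ (List.ofFn b).prod := by
  induction k with
  | zero => simp [Algebra.TensorProduct.one_def]
  | succ k ih => simp [List.ofFn_succ, ih]

/-- The coefficient of the product of all the generators, with values in an algebra. -/
def topCoeffTensor (n : ℕ) (A : Type*) [Ring A] [Algebra ℂ A] : Grassmann n ⊗[ℂ] A →ₗ[ℂ] A :=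
  TensorProduct.lid ℂ A ∘ₗ LinearMap.rTensor A (topCoeff n)

theorem topCoeffTensor_tmul {n : ℕ} (l : Grassmann n) (a : A) :
    topCoeffTensor n A (l ⊗ₜ a) = topCoeff n l • a := by
  simp [topCoeffTensor]

/-- The element `∑ ξ i ξ j ⊗ m i j`. -/
def quadratic {n : ℕ} (m : Fin n → Fin n → A) : Grassmann n ⊗[ℂ] A :=
  ∑ i, ∑ j, (oddVar i * oddVar j) ⊗ₜ m i j

/-- The power expands over words of length `2k`; words with a repeated letter vanish and
permutations give their sign. Factors in `A` stay in order, so the lemma serves both noncommutative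
algebras such as `U(g)` and `P(g)`. -/
theorem topCoeffTensor_quadratic_pow {k : ℕ} (m : Fin (2 * k) → Fin (2 * k) → A) :
    topCoeffTensor (2 * k) A (quadratic m ^ k) = ∑ σ : Equiv.Perm (Fin (2 * k)),
      (Equiv.Perm.sign σ : ℂ) • (List.ofFn fun i => m (σ (fstIdx i)) (σ (sndIdx i))).prod := by
  have h1 : quadratic m ^ k = ∑ f : Fin (2 * k) → Fin (2 * k),
      (List.ofFn fun i => oddVar (f i)).prod ⊗ₜ[ℂ]
        (List.ofFn fun i => m (f (fstIdx i)) (f (sndIdx i))).prod := by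
    have h := (MultilinearMap.mkPiAlgebraFin ℂ k (Grassmann (2 * k) ⊗[ℂ] A)).map_sum
      (fun _ (p : Fin (2 * k) × Fin (2 * k)) => (oddVar p.1 * oddVar p.2) ⊗ₜ[ℂ] m p.1 p.2)
    simp only [MultilinearMap.mkPiAlgebraFin_apply, List.ofFn_const, List.prod_replicate] at h
    rw [quadratic, ← Fintype.sum_prod_type', h, ← Equiv.sum_comp (pairingEquiv k _)]
    refine Finset.sum_congr rfl fun f _ => ?_
    rw [prod_ofFn_tmul, ← prod_ofFn_pairs]
    rfl
  rw [h1, map_sum]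
  simp only [topCoeffTensor_tmul]
  symm
  refine Finset.sum_of_injOn (fun σ : Equiv.Perm (Fin (2 * k)) => (σ : Fin (2 * k) → Fin (2 * k)))
    DFunLike.coe_injective.injOn (by simp) (fun f _ hf => ?_) (fun σ _ => ?_)
  · rw [topCoeff_prod_of_not_injective, zero_smul]
    intro hi
    exact hf ⟨Equiv.ofBijective f (Finite.injective_iff_bijective.1 hi), by simp, rfl⟩
  · rw [topCoeff_prod_perm]

theorem quadratic_add {n : ℕ} (m m' : Fin n → Fin n → A) :
    quadratic (fun i j => m i j + m' i j) = quadratic m + quadratic m' := by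
  simp [quadratic, TensorProduct.tmul_add, Finset.sum_add_distrib]

theorem quadratic_swap {n : ℕ} (m : Fin n → Fin n → A) :
    quadratic (fun i j => m j i) = - quadratic m := by
  rw [quadratic, Finset.sum_comm, quadratic]
  simp only [← Finset.sum_neg_distrib]
  refine Finset.sum_congr rfl fun i _ => Finset.sum_congr rfl fun j _ => ?_
  rw [oddVar_mul_oddVar, TensorProduct.neg_tmul]

theorem quadratic_smul {n : ℕ} (c : ℂ) (m : Fin n → Fin n → A) :
    quadratic (fun i j => c • m i j) = c • quadratic m := by
  simp [quadratic, Finset.smul_sum, TensorProduct.tmul_smul]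

/-- In an associative algebra, the alternating sum of products can be written with commutators. -/
theorem sum_sign_prod_eq {k : ℕ} (a : Fin (2 * k) → A) :
    ∑ σ : Equiv.Perm (Fin (2 * k)), (Equiv.Perm.sign σ : ℂ) • (List.ofFn fun i => a (σ i)).prod =
      (2 ^ k : ℂ)⁻¹ • ∑ σ : Equiv.Perm (Fin (2 * k)), (Equiv.Perm.sign σ : ℂ) •
        (List.ofFn fun i : Fin k => a (σ (fstIdx i)) * a (σ (sndIdx i)) -
          a (σ (sndIdx i)) * a (σ (fstIdx i))).prod := by
  have h1 := topCoeffTensor_quadratic_pow (k := k) fun i j => a i * a j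
  have h2 := topCoeffTensor_quadratic_pow (k := k) fun i j => a i * a j - a j * a i
  -- Transposing the matrix negates `quadratic`, as the generators anticommute; each commutator
  -- therefore contributes a factor `2`.
  have h3 : quadratic (fun i j => a i * a j - a j * a i) =
      (2 : ℂ) • quadratic (fun i j => a i * a j) := by
    have := quadratic_add (fun i j => a i * a j) (fun i j => (-1 : ℂ) • (a j * a i))
    simp only [neg_smul, one_smul, ← sub_eq_add_neg] at this
    have h4 := quadratic_smul (-1) (fun i j => a j * a i)
    rw [quadratic_swap fun i j => a i * a j] at h4
    simp only [neg_smul, one_smul, neg_neg] at h4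
    rw [this, h4, two_smul]
  rw [← h2, h3, smul_pow, map_smul, h1, smul_smul, inv_mul_cancel₀ (by simp), one_smul]
  refine Finset.sum_congr rfl fun σ _ => ?_
  rw [← prod_ofFn_pairs]

end Grassmann

/-! ### Homogeneous components in the symmetric algebra -/

section Homogeneous

variable {V : Type*} [AddCommGroup V] [Module ℂ V]

/-- The algebra map that multiplies each generator by an indeterminate. -/
def scaling (V : Type*) [AddCommGroup V] [Module ℂ V] :
    SymmetricAlgebra ℂ V →ₐ[ℂ] Polynomial (SymmetricAlgebra ℂ V) :=
  SymmetricAlgebra.lift (LinearMap.mulRight ℂ Polynomial.X ∘ₗ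
    (Polynomial.CAlgHom (R := ℂ)).toLinearMap ∘ₗ SymmetricAlgebra.ι ℂ V)

theorem scaling_ι (v : V) :
    scaling V (SymmetricAlgebra.ι ℂ V v) =
      Polynomial.C (SymmetricAlgebra.ι ℂ V v) * Polynomial.X :=
  SymmetricAlgebra.lift_ι_apply _ _

theorem scaling_algebraMap (c : ℂ) :
    scaling V (algebraMap ℂ _ c) = Polynomial.C (algebraMap ℂ _ c) :=
  (scaling V).commutes c

theorem eval_one_scaling (p : SymmetricAlgebra ℂ V) : (scaling V p).eval 1 = p := by
  induction p using SymmetricAlgebra.induction with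
  | algebraMap r => simp
  | ι v => simp [scaling_ι]
  | mul a b ha hb => simp [ha, hb]
  | add a b ha hb => simp [ha, hb]

theorem coeff_scaling_mem (p : SymmetricAlgebra ℂ V) (j : ℕ) :
    (scaling V p).coeff j ∈ LinearMap.range (SymmetricAlgebra.ι ℂ V) ^ j := by
  induction p using SymmetricAlgebra.induction generalizing j with
  | algebraMap r =>
    rw [scaling_algebraMap, Polynomial.coeff_C]
    split_ifs with h
    · rw [h, pow_zero]
      exact Submodule.algebraMap_mem r
    · exact zero_mem _
  | ι v =>
    rw [scaling_ι, Polynomial.coeff_C_mul, Polynomial.coeff_X]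
    split_ifs with h
    · rw [← h, pow_one, mul_one]
      exact ⟨v, rfl⟩
    · rw [mul_zero]
      exact zero_mem _
  | mul a b ha hb =>
    rw [map_mul, Polynomial.coeff_mul]
    refine sum_mem fun x hx => ?_
    rw [← Finset.HasAntidiagonal.mem_antidiagonal.1 hx, pow_add]
    exact Submodule.mul_mem_mul (ha _) (hb _)
  | add a b ha hb =>
    rw [map_add, Polynomial.coeff_add]
    exact add_mem (ha j) (hb j)

theorem coeff_zero_scaling (p : SymmetricAlgebra ℂ V) :
    (scaling V p).coeff 0 = algebraMap ℂ _ (SymmetricAlgebra.algebraMapInv p) := by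
  induction p using SymmetricAlgebra.induction with
  | algebraMap r => simp
  | ι v => simp [scaling_ι, SymmetricAlgebra.algebraMapInv_ι]
  | mul a b ha hb => simp [ha, hb, Polynomial.mul_coeff_zero]
  | add a b ha hb => simp [ha, hb]

/-- A derivation induced by an endomorphism of `V` preserves degree. Consequently the homogeneous
components of an invariant are invariant. -/
theorem coeff_scaling_deriv (f : V →ₗ[ℂ] V) (p : SymmetricAlgebra ℂ V) (j : ℕ) :
    (scaling V (deriv (SymmetricAlgebra.ι ℂ V ∘ₗ f) p)).coeff j =
      deriv (SymmetricAlgebra.ι ℂ V ∘ₗ f) ((scaling V p).coeff j) := by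
  induction p using SymmetricAlgebra.induction generalizing j with
  | algebraMap r =>
    rw [Derivation.map_algebraMap, map_zero, scaling_algebraMap, Polynomial.coeff_C]
    split_ifs <;> simp
  | ι v =>
    rw [deriv_ι, LinearMap.comp_apply, scaling_ι, scaling_ι, Polynomial.coeff_C_mul,
      Polynomial.coeff_C_mul, Polynomial.coeff_X]
    split_ifs <;> simp [deriv_ι]
  | mul a b ha hb =>
    rw [Derivation.leibniz, map_add, smul_eq_mul, smul_eq_mul, map_mul, map_mul, map_mul,
      Polynomial.coeff_add, Polynomial.coeff_mul, Polynomial.coeff_mul, Polynomial.coeff_mul,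
      map_sum, ← Finset.Nat.sum_antidiagonal_swap (f := fun x => (scaling V b).coeff x.1 * _),
      ← Finset.sum_add_distrib]
    refine Finset.sum_congr rfl fun x _ => ?_
    rw [Derivation.leibniz, ha, hb]
    rfl
  | add a b ha hb => simp [ha, hb]

theorem euler_of_mem {j : ℕ} {p : SymmetricAlgebra ℂ V}
    (hp : p ∈ LinearMap.range (SymmetricAlgebra.ι ℂ V) ^ j) :
    deriv (SymmetricAlgebra.ι ℂ V) p = (j : ℂ) • p := by
  induction hp using Submodule.pow_induction_on_left' with
  | algebraMap r => simp
  | add x y i hx hy ihx ihy => rw [map_add, ihx, ihy, smul_add]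
  | mem_mul m hm i x hx ih =>
    obtain ⟨v, rfl⟩ := hm
    rw [Derivation.leibniz, ih, deriv_ι, smul_eq_mul, smul_eq_mul, Nat.cast_succ, add_smul,
      one_smul, mul_smul_comm, mul_comm x]

end Homogeneous

/-! ### Harmonicity -/

section Grassmann

open scoped TensorProduct

/-- The center of the Grassmann algebra. -/
abbrev GrassmannCenter (n : ℕ) : Subalgebra ℂ (Grassmann n) := Subalgebra.center ℂ (Grassmann n)

/-- A generator passes two odd factors with two sign changes. Centrality supplies the commutative
target that evaluation of `P(g)` at the curvature needs. -/
theorem oddVar_mul_mem_center {n : ℕ} (i j : Fin n) :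
    oddVar i * oddVar j ∈ GrassmannCenter n := by
  rw [Subalgebra.mem_center_iff]
  intro l
  induction l using ExteriorAlgebra.induction with
  | algebraMap r => exact Algebra.commutes _ _
  | ι v =>
    have h (a b : Fin n → ℂ) : ExteriorAlgebra.ι ℂ a * ExteriorAlgebra.ι ℂ b =
        -(ExteriorAlgebra.ι ℂ b * ExteriorAlgebra.ι ℂ a) :=
      eq_neg_of_add_eq_zero_left (ExteriorAlgebra.ι_add_mul_swap _ _)
    rw [oddVar, oddVar, ← mul_assoc, h v, neg_mul, mul_assoc, h v, mul_neg, neg_neg, mul_assoc]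
  | mul a b ha hb => rw [mul_assoc, hb, ← mul_assoc, ha, mul_assoc]
  | add a b ha hb => rw [add_mul, mul_add, ha, hb]

/-- The product of two generators, as a central element. -/
def evenVar {n : ℕ} (i j : Fin n) : GrassmannCenter n :=
  ⟨oddVar i * oddVar j, oddVar_mul_mem_center i j⟩

variable {g : Type*} [LieRing g] [LieAlgebra ℂ g] {n : ℕ}

/-- The algebra map `y ↦ ∑ B(y, [x i, x j]) ξ i ξ j`. -/
def curvatureEval (B : LinearMap.BilinForm ℂ g) (x : Fin n → g) :
    SymmetricAlgebra ℂ g →ₐ[ℂ] GrassmannCenter n :=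
  SymmetricAlgebra.lift
    (∑ i, ∑ j, (LinearMap.toSpanSingleton ℂ _ (evenVar i j)) ∘ₗ B.flip ⁅x i, x j⁆)

theorem curvatureEval_ι (B : LinearMap.BilinForm ℂ g) (x : Fin n → g) (y : g) :
    curvatureEval B x (SymmetricAlgebra.ι ℂ g y) = ∑ i, ∑ j, B y ⁅x i, x j⁆ • evenVar i j := by
  rw [curvatureEval, SymmetricAlgebra.lift_ι_apply]
  simp

theorem sum_rotate {M : Type*} [AddCommMonoid M] (F : Fin n → Fin n → Fin n → M) :
    ∑ i, ∑ j, ∑ k, F j k i = ∑ i, ∑ j, ∑ k, F i j k := by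
  rw [Finset.sum_comm]
  exact Finset.sum_congr rfl fun i _ => Finset.sum_comm

theorem oddVar_rotate (i j k : Fin n) :
    oddVar j * (oddVar k * oddVar i) = oddVar i * (oddVar j * oddVar k) := by
  have := Subalgebra.mem_center_iff.1 (oddVar_mul_mem_center j k) (oddVar i)
  rw [this, mul_assoc]

variable {B : LinearMap.BilinForm ℂ g} (hB : IsInvariantForm B) (x : Fin n → g)
include hB in
-- The Bianchi identity. On generators it is the Jacobi identity, and the Leibniz rule extends it to
-- all `p`, invariant or not.
theorem sum_oddVar_mul_curvatureEval_adP (p : SymmetricAlgebra ℂ g) :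
    ∑ j, oddVar j * (curvatureEval B x (adP (x j) p) : Grassmann n) = 0 := by
  induction p using SymmetricAlgebra.induction with
  | algebraMap r => simp
  | ι y =>
    have h1 : ∀ j, oddVar j * (curvatureEval B x (adP (x j) (SymmetricAlgebra.ι ℂ g y)) :
        Grassmann n) = -∑ k, ∑ l, B y ⁅x j, ⁅x k, x l⁆⁆ • (oddVar j * (oddVar k * oddVar l)) := by
      intro j
      have : adP (x j) (SymmetricAlgebra.ι ℂ g y) = SymmetricAlgebra.ι ℂ g ⁅x j, y⁆ := by
        rw [adP, deriv_ι]; rfl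
      rw [this, curvatureEval_ι]
      simp only [AddSubmonoidClass.coe_finsetSum, Subalgebra.coe_smul, Finset.mul_sum,
        ← Finset.sum_neg_distrib, evenVar]
      refine Finset.sum_congr rfl fun k _ => Finset.sum_congr rfl fun l _ => ?_
      rw [← lie_skew (x j) y, map_neg, LinearMap.neg_apply, hB.invariant, neg_smul, mul_neg,
        mul_smul_comm]
    simp only [h1, Finset.sum_neg_distrib, neg_eq_zero]
    -- A product of three generators is unchanged by cyclic rotation, so `S` equals its two
    -- rotations; the three add up to zero by Jacobi.
    set S := ∑ j, ∑ k, ∑ l, B y ⁅x j, ⁅x k, x l⁆⁆ • (oddVar j * (oddVar k * oddVar l)) with hS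
    have h2 : S = ∑ j, ∑ k, ∑ l, B y ⁅x k, ⁅x l, x j⁆⁆ • (oddVar j * (oddVar k * oddVar l)) := by
      rw [hS, ← sum_rotate]
      simp only [oddVar_rotate]
    have h3 : S = ∑ j, ∑ k, ∑ l, B y ⁅x l, ⁅x j, x k⁆⁆ • (oddVar j * (oddVar k * oddVar l)) := by
      rw [h2, ← sum_rotate]
      simp only [oddVar_rotate]
    have h4 : S + S + S = 0 := by
      nth_rw 2 [h2]
      rw [h3]
      nth_rw 1 [← h3, hS]
      simp only [← Finset.sum_add_distrib, ← add_smul, ← map_add, lie_jacobi, map_zero, zero_smul,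
        Finset.sum_const_zero]
    have h5 : (3 : ℂ) • S = 0 := by
      rw [← h4]
      module
    exact (smul_eq_zero.1 h5).resolve_left (by norm_num)
  | mul a b ha hb =>
    have (j : Fin n) : oddVar j * (curvatureEval B x (adP (x j) (a * b)) : Grassmann n) =
        oddVar j * (curvatureEval B x (adP (x j) b) : Grassmann n) * (curvatureEval B x a) +
          oddVar j * (curvatureEval B x (adP (x j) a) : Grassmann n) * (curvatureEval B x b) := by
      rw [Derivation.leibniz, smul_eq_mul, smul_eq_mul, mul_comm a, mul_comm b, map_add, map_mul,
        map_mul, Subalgebra.coe_add, Subalgebra.coe_mul, Subalgebra.coe_mul, mul_add, mul_assoc,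
        mul_assoc]
    simp only [this, Finset.sum_add_distrib, ← Finset.sum_mul, ha, hb, zero_mul, add_zero]
  | add a b ha hb => simp [mul_add, Finset.sum_add_distrib, ha, hb]

include hB in
-- The Euler field at the point `Ω` is the derivative in the direction `Ω` itself.
theorem curvatureEval_euler (p : SymmetricAlgebra ℂ g) :
    curvatureEval B x (deriv (SymmetricAlgebra.ι ℂ g) p) =
      ∑ i, ∑ j, evenVar i j * curvatureEval B x (partialD B ⁅x i, x j⁆ p) := by
  induction p using SymmetricAlgebra.induction with
  | algebraMap r => simp
  | ι y =>
    rw [deriv_ι, curvatureEval_ι]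
    refine Finset.sum_congr rfl fun i _ => Finset.sum_congr rfl fun j _ => ?_
    rw [partialD, deriv_ι, LinearMap.comp_apply, Algebra.linearMap_apply, AlgHom.commutes,
      hB.symm, Algebra.smul_def, mul_comm]
  | mul a b ha hb =>
    rw [Derivation.leibniz, map_add, smul_eq_mul, smul_eq_mul, map_mul, map_mul, ha, hb]
    simp only [Finset.mul_sum, ← Finset.sum_add_distrib]
    refine Finset.sum_congr rfl fun i _ => Finset.sum_congr rfl fun j _ => ?_
    rw [Derivation.leibniz, map_add, smul_eq_mul, smul_eq_mul, map_mul, map_mul]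
    ring
  | add a b ha hb => simp [mul_add, Finset.sum_add_distrib, ha, hb]

include hB in
theorem partialD_adP (y z : g) (p : SymmetricAlgebra ℂ g) :
    partialD B y (adP z p) = adP z (partialD B y p) + partialD B ⁅y, z⁆ p := by
  have h : ⁅partialD B y, adP z⁆ = partialD B ⁅y, z⁆ := derivation_ext fun v => by
    simp [Derivation.commutator_apply, partialD, adP, deriv_ι, hB.invariant]
  rw [← h, Derivation.commutator_apply]
  abel

include hB in
-- Differentiate `adP (x j) p = 0` along `x i` and sum against `ξ_i ξ_j`. By the Bianchi identity
-- for `∂_{x i} p` the terms with `adP` outside vanish; the commutator terms are the Euler sum.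
theorem curvatureEval_euler_of_isInvariant {p : SymmetricAlgebra ℂ g} (hp : IsInvariant p) :
    curvatureEval B x (deriv (SymmetricAlgebra.ι ℂ g) p) = 0 := by
  have h1 : ∑ i, ∑ j, oddVar i * oddVar j *
      (curvatureEval B x (partialD B (x i) (adP (x j) p)) : Grassmann n) = 0 := by
    simp [hp _]
  simp only [partialD_adP hB, map_add, Subalgebra.coe_add, mul_add, Finset.sum_add_distrib,
    mul_assoc (oddVar _) (oddVar _) (Subtype.val _), ← Finset.mul_sum,
    sum_oddVar_mul_curvatureEval_adP hB, mul_zero, zero_add] at h1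
  apply Subtype.ext
  rw [curvatureEval_euler hB]
  simp only [AddSubmonoidClass.coe_finsetSum, Subalgebra.coe_mul, evenVar, mul_assoc,
    ← Finset.mul_sum]
  exact h1

include hB in
theorem curvatureEval_eq_zero {p : SymmetricAlgebra ℂ g} (hp : IsInvariant p) {j : ℕ} (hj : j ≠ 0)
    (hpj : p ∈ homogeneous g j) : curvatureEval B x p = 0 := by
  have h := curvatureEval_euler_of_isInvariant hB x hp
  rw [euler_of_mem hpj, map_smul] at h
  exact (smul_eq_zero.1 h).resolve_left (Nat.cast_ne_zero.2 hj)

/-- The curvature `∑ ξ i ξ j ⊗ [x i, x j]` with values in the symmetric algebra. -/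
def curvature (x : Fin n → g) : GrassmannCenter n ⊗[ℂ] SymmetricAlgebra ℂ g :=
  ∑ i, ∑ j, evenVar i j ⊗ₜ SymmetricAlgebra.ι ℂ g ⁅x i, x j⁆

theorem lTensor_tmul_mul {R : Type*} [CommRing R] [Algebra ℂ R]
    (D : Derivation ℂ (SymmetricAlgebra ℂ g) (SymmetricAlgebra ℂ g)) (r : R)
    (a : SymmetricAlgebra ℂ g) (u : R ⊗[ℂ] SymmetricAlgebra ℂ g) :
    LinearMap.lTensor R (D : SymmetricAlgebra ℂ g →ₗ[ℂ] SymmetricAlgebra ℂ g) ((r ⊗ₜ a) * u) =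
      (r ⊗ₜ a) * LinearMap.lTensor R (D : SymmetricAlgebra ℂ g →ₗ[ℂ] SymmetricAlgebra ℂ g) u +
        (r ⊗ₜ D a) * u := by
  induction u with
  | zero => simp
  | tmul s b =>
    simp only [Algebra.TensorProduct.tmul_mul_tmul, LinearMap.lTensor_tmul,
      ← TensorProduct.tmul_add]
    congr 1
    change D (a * b) = _
    rw [D.leibniz, smul_eq_mul, smul_eq_mul, mul_comm b]
    rfl
  | add u v hu hv =>
    rw [mul_add, map_add, hu, hv, map_add]
    ring

theorem lTensor_partialD_curvature_mul (y : g)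
    (u : GrassmannCenter n ⊗[ℂ] SymmetricAlgebra ℂ g) :
    LinearMap.lTensor (GrassmannCenter n) (partialLin B y) (curvature x * u) =
      curvature x * LinearMap.lTensor (GrassmannCenter n) (partialLin B y) u +
        (curvatureEval B x (SymmetricAlgebra.ι ℂ g y) ⊗ₜ 1) * u := by
  rw [curvatureEval_ι, curvature]
  simp only [Finset.sum_mul, TensorProduct.sum_tmul, map_sum, ← Finset.sum_add_distrib]
  refine Finset.sum_congr rfl fun i _ => Finset.sum_congr rfl fun j _ => ?_
  refine (lTensor_tmul_mul (partialD B y) _ _ _).trans ?_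
  rw [partialD, deriv_ι, LinearMap.comp_apply, Algebra.linearMap_apply,
    Algebra.algebraMap_eq_smul_one, TensorProduct.tmul_smul, TensorProduct.smul_tmul']
  rfl

/-- The power rule, valid since `∂_y` of the curvature is a scalar from the commutative Grassmann
part. At `k = 0` the truncated exponent is harmless because of the factor `k`. -/
theorem lTensor_partialD_curvature_pow (y : g) (k : ℕ) :
    LinearMap.lTensor (GrassmannCenter n) (partialLin B y) (curvature x ^ k) =
      (k : ℂ) • ((curvatureEval B x (SymmetricAlgebra.ι ℂ g y) ⊗ₜ 1) * curvature x ^ (k - 1)) := by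
  induction k with
  | zero =>
    have : partialLin B y 1 = 0 := (partialD B y).map_one_eq_zero
    simp [Algebra.TensorProduct.one_def, this]
  | succ k ih =>
    rw [pow_succ', lTensor_partialD_curvature_mul, ih]
    rcases k with _ | k
    · simp
    · rw [mul_smul_comm, mul_left_comm, Nat.add_sub_cancel, Nat.add_sub_cancel, ← pow_succ',
        Nat.cast_succ (k + 1), add_smul, one_smul]

theorem diffOp_ι_mul (y : g) (p : SymmetricAlgebra ℂ g) :
    (diffOp B (SymmetricAlgebra.ι ℂ g y * p) : Module.End ℂ (SymmetricAlgebra ℂ g)) =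
      partialLin B y ∘ₗ (diffOp B p : Module.End ℂ (SymmetricAlgebra ℂ g)) := by
  rw [map_mul, diffOp, SymmetricAlgebra.lift_ι_apply]
  rfl

/-- Iteration of the power rule. For `j > k` the descending factorial vanishes, so the truncated
exponent does not matter. -/
theorem lTensor_diffOp_curvature_pow {j : ℕ} {p : SymmetricAlgebra ℂ g}
    (hp : p ∈ homogeneous g j) (k : ℕ) :
    LinearMap.lTensor (GrassmannCenter n)
      (diffOp B p : Module.End ℂ (SymmetricAlgebra ℂ g)) (curvature x ^ k) =
      (k.descFactorial j : ℂ) • ((curvatureEval B x p ⊗ₜ 1) * curvature x ^ (k - j)) := by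
  induction hp using Submodule.pow_induction_on_left' with
  | algebraMap r =>
    have h : (diffOp B (algebraMap ℂ _ r) : Module.End ℂ (SymmetricAlgebra ℂ g)) =
        r • LinearMap.id := by
      rw [AlgHom.commutes]
      rfl
    rw [h, LinearMap.lTensor_smul, LinearMap.lTensor_id, AlgHom.commutes,
      Algebra.algebraMap_eq_smul_one r, ← TensorProduct.smul_tmul', ← Algebra.TensorProduct.one_def]
    simp
  | add p q i hp hq ihp ihq =>
    rw [map_add, map_add, Subalgebra.coe_add, LinearMap.lTensor_add, LinearMap.add_apply, ihp, ihq,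
      TensorProduct.add_tmul, add_mul, smul_add]
  | mem_mul m hm i p hp ih =>
    obtain ⟨y, rfl⟩ := hm
    have h1 (z : GrassmannCenter n) (u : GrassmannCenter n ⊗[ℂ] SymmetricAlgebra ℂ g) :
        LinearMap.lTensor (GrassmannCenter n) (partialLin B y) ((z ⊗ₜ 1) * u) =
          (z ⊗ₜ 1) * LinearMap.lTensor (GrassmannCenter n) (partialLin B y) u := by
      have := lTensor_tmul_mul (partialD B y) z 1 u
      rwa [Derivation.map_one_eq_zero, TensorProduct.tmul_zero, zero_mul, add_zero] at this
    rw [diffOp_ι_mul, LinearMap.lTensor_comp, LinearMap.comp_apply, ih, map_smul, h1,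
      lTensor_partialD_curvature_pow, map_mul, Nat.descFactorial_succ, Nat.cast_mul, Nat.sub_sub,
      mul_comm ((k - i : ℕ) : ℂ), mul_smul, mul_smul_comm, ← mul_assoc,
      Algebra.TensorProduct.tmul_mul_tmul, one_mul, mul_comm (curvatureEval B x p)]

/-- The top coefficient of an element of the tensor product with the center. -/
def topCoeffCenter (n : ℕ) (g : Type*) [LieRing g] [LieAlgebra ℂ g] :
    GrassmannCenter n ⊗[ℂ] SymmetricAlgebra ℂ g →ₗ[ℂ] SymmetricAlgebra ℂ g :=
  topCoeffTensor n (SymmetricAlgebra ℂ g) ∘ₗ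
    LinearMap.rTensor (SymmetricAlgebra ℂ g) (GrassmannCenter n).val.toLinearMap

theorem topCoeffCenter_lTensor (F : Module.End ℂ (SymmetricAlgebra ℂ g))
    (u : GrassmannCenter n ⊗[ℂ] SymmetricAlgebra ℂ g) :
    topCoeffCenter n g (LinearMap.lTensor _ F u) = F (topCoeffCenter n g u) := by
  induction u with
  | zero => simp
  | tmul z a => simp [topCoeffCenter, topCoeffTensor_tmul]
  | add u v hu hv => simp only [map_add, hu, hv]

theorem topCoeffCenter_curvature_pow {k : ℕ} (x : Fin (2 * k) → g) :
    topCoeffCenter (2 * k) g (curvature x ^ k) = ∑ σ : Equiv.Perm (Fin (2 * k)),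
      (Equiv.Perm.sign σ : ℂ) •
        ∏ i : Fin k, SymmetricAlgebra.ι ℂ g ⁅x (σ (fstIdx i)), x (σ (sndIdx i))⁆ := by
  have h := topCoeffTensor_quadratic_pow (k := k) fun i j => SymmetricAlgebra.ι ℂ g ⁅x i, x j⁆
  simp only [List.prod_ofFn] at h
  rw [← h]
  let F := Algebra.TensorProduct.map (GrassmannCenter (2 * k)).val
    (AlgHom.id ℂ (SymmetricAlgebra ℂ g))
  have hF : F (curvature x) = quadratic fun i j => SymmetricAlgebra.ι ℂ g ⁅x i, x j⁆ := by
    simp [F, curvature, quadratic, evenVar]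
  rw [← hF, ← map_pow]
  rfl

include hB in
-- Split `p` into homogeneous components: the constant one is zero by assumption, and each of the
-- others is invariant and vanishes at the curvature.
theorem isHarmonic_topCoeffCenter_curvature_pow (k : ℕ) :
    IsHarmonic B (topCoeffCenter n g (curvature x ^ k)) := by
  intro p hp hp0
  have hsum : p = ∑ j ∈ Finset.range ((scaling g p).natDegree + 1), (scaling g p).coeff j := by
    conv_lhs => rw [← eval_one_scaling p, Polynomial.eval_eq_sum_range]
    simp
  rw [hsum, map_sum, AddSubmonoidClass.coe_finsetSum, LinearMap.sum_apply]
  refine Finset.sum_eq_zero fun j _ => ?_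
  rcases eq_or_ne j 0 with rfl | hj
  · rw [coeff_zero_scaling, hp0, map_zero, map_zero]
    rfl
  · have hinv : IsInvariant ((scaling g p).coeff j) := fun y => by
      rw [adP, ← coeff_scaling_deriv]
      change (scaling g (adP y p)).coeff j = 0
      rw [hp y, map_zero, Polynomial.coeff_zero]
    have hmem : (scaling g p).coeff j ∈ homogeneous g j := coeff_scaling_mem p j
    rw [← topCoeffCenter_lTensor, lTensor_diffOp_curvature_pow x hmem,
      curvatureEval_eq_zero hB x hinv hj hmem, TensorProduct.zero_tmul, zero_mul, smul_zero,
      map_zero]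

end Grassmann

/-! ### Permutations of the standard pairs -/

section Pairs

variable {k : ℕ}

/-- The bijection of `Fin k × Fin 2` with `Fin (2 * k)` that enumerates the standard pairs. -/
def pairIndex (k : ℕ) : Fin k × Fin 2 ≃ Fin (2 * k) :=
  finProdFinEquiv.trans (finCongr (mul_comm k 2))

theorem pairIndex_zero (i : Fin k) : pairIndex k (i, 0) = fstIdx i := by
  ext
  simp [pairIndex, fstIdx]

theorem pairIndex_one (i : Fin k) : pairIndex k (i, 1) = sndIdx i := by
  ext
  simp [pairIndex, sndIdx, add_comm]

/-- The permutation of the standard pairs that preserves the order within the pairs. -/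
def blockPerm (π : Equiv.Perm (Fin k)) : Equiv.Perm (Fin (2 * k)) :=
  (pairIndex k).permCongr (Equiv.prodCongrLeft fun _ => π)

theorem blockPerm_fstIdx (π : Equiv.Perm (Fin k)) (i : Fin k) :
    blockPerm π (fstIdx i) = fstIdx (π i) := by
  simp [blockPerm, ← pairIndex_zero]

theorem blockPerm_sndIdx (π : Equiv.Perm (Fin k)) (i : Fin k) :
    blockPerm π (sndIdx i) = sndIdx (π i) := by
  simp [blockPerm, ← pairIndex_one]

/-- The permutation acts as `π` once on the first members and once on the second, so its sign is a
square. -/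
theorem sign_blockPerm (π : Equiv.Perm (Fin k)) : Equiv.Perm.sign (blockPerm π) = 1 := by
  rw [blockPerm, Equiv.Perm.sign_permCongr, Equiv.Perm.sign_prodCongrLeft]
  simp

/-- The permutation that preserves each standard pair, with prescribed restrictions. -/
def flipPerm (e : Fin k → Equiv.Perm (Fin 2)) : Equiv.Perm (Fin (2 * k)) :=
  (pairIndex k).permCongr (Equiv.prodCongrRight e)

theorem flipPerm_fstIdx (e : Fin k → Equiv.Perm (Fin 2)) (i : Fin k) :
    flipPerm e (fstIdx i) = pairIndex k (i, e i 0) := by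
  simp [flipPerm, ← pairIndex_zero]

theorem flipPerm_sndIdx (e : Fin k → Equiv.Perm (Fin 2)) (i : Fin k) :
    flipPerm e (sndIdx i) = pairIndex k (i, e i 1) := by
  simp [flipPerm, ← pairIndex_one]

theorem sign_flipPerm (e : Fin k → Equiv.Perm (Fin 2)) :
    Equiv.Perm.sign (flipPerm e) = ∏ i, Equiv.Perm.sign (e i) := by
  rw [flipPerm, Equiv.Perm.sign_permCongr, Equiv.Perm.sign_prodCongrRight]

/-- The wreath product decomposition: `h` induces a permutation `π` of the pairs, and what remains
is a bijection within each pair. -/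
theorem exists_eq_blockPerm_mul_flipPerm {h : Equiv.Perm (Fin (2 * k))} (hh : h ∈ pairSubgroup k) :
    ∃ (π : Equiv.Perm (Fin k)) (e : Fin k → Equiv.Perm (Fin 2)), h = blockPerm π * flipPerm e := by
  have hset (i : Fin k) :
      ({fstIdx i, sndIdx i} : Set (Fin (2 * k))) = {j | ((pairIndex k).symm j).1 = i} := by
    ext j
    obtain ⟨⟨a, b⟩, rfl⟩ := (pairIndex k).surjective j
    rw [← pairIndex_zero, ← pairIndex_one]
    fin_cases b <;> simp
  have hπ (i : Fin k) : ∃ i', h '' {j | ((pairIndex k).symm j).1 = i} =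
      {j | ((pairIndex k).symm j).1 = i'} := by
    have h1 : h • ({fstIdx i, sndIdx i} : Set (Fin (2 * k))) ∈ h • stdPairs k :=
      Set.smul_mem_smul_set ⟨i, rfl⟩
    rw [MulAction.mem_stabilizer_iff.1 hh] at h1
    obtain ⟨i', hi'⟩ := h1
    refine ⟨i', ?_⟩
    rw [← hset, ← hset]
    exact hi'.symm
  choose π hπ using hπ
  have hinj : Function.Injective π := fun i i' hii => by
    have h1 : ({j | ((pairIndex k).symm j).1 = i} : Set (Fin (2 * k))) =
        {j | ((pairIndex k).symm j).1 = i'} :=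
      h.injective.image_injective (by rw [hπ, hπ, hii])
    have h2 : fstIdx i ∈ ({j | ((pairIndex k).symm j).1 = i} : Set (Fin (2 * k))) := by
      rw [← hset]
      simp
    rw [h1, ← pairIndex_zero] at h2
    simpa using h2
  have hfst (i : Fin k) (b : Fin 2) : ((pairIndex k).symm (h (pairIndex k (i, b)))).1 = π i := by
    have : h (pairIndex k (i, b)) ∈ h '' {j | ((pairIndex k).symm j).1 = i} :=
      ⟨_, by simp, rfl⟩
    rwa [hπ] at this
  let e (i : Fin k) (b : Fin 2) : Fin 2 := ((pairIndex k).symm (h (pairIndex k (i, b)))).2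
  have hval (i : Fin k) (b : Fin 2) : h (pairIndex k (i, b)) = pairIndex k (π i, e i b) := by
    rw [← hfst i b]
    simp [e]
  have he (i : Fin k) : Function.Injective (e i) := fun b b' hbb => by
    have h1 : h (pairIndex k (i, b)) = h (pairIndex k (i, b')) := by rw [hval, hval, hbb]
    simpa using h1
  refine ⟨Equiv.ofBijective π (Finite.injective_iff_bijective.1 hinj),
    fun i => Equiv.ofBijective (e i) (Finite.injective_iff_bijective.1 (he i)), ?_⟩
  ext j : 1
  obtain ⟨⟨i, b⟩, rfl⟩ := (pairIndex k).surjective j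
  rw [hval]
  simp [blockPerm, flipPerm]

variable {R : Type*} [CommRing R] [Algebra ℂ R]

/-- The signed product of the values of a matrix on the pairs of a permutation. -/
def pairTerm (c : Fin (2 * k) → Fin (2 * k) → R) (σ : Equiv.Perm (Fin (2 * k))) : R :=
  (Equiv.Perm.sign σ : ℂ) • ∏ i : Fin k, c (σ (fstIdx i)) (σ (sndIdx i))

theorem pairTerm_mul_blockPerm (c : Fin (2 * k) → Fin (2 * k) → R) (σ : Equiv.Perm (Fin (2 * k)))
    (π : Equiv.Perm (Fin k)) : pairTerm c (σ * blockPerm π) = pairTerm c σ := by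
  simp only [pairTerm, map_mul, sign_blockPerm, mul_one, Equiv.Perm.mul_apply, blockPerm_fstIdx,
    blockPerm_sndIdx]
  rw [Equiv.prod_comp π fun i => c (σ (fstIdx i)) (σ (sndIdx i))]

/-- Each flip changes both the sign of the permutation and, by antisymmetry, the sign of one factor.
-/
theorem pairTerm_mul_flipPerm {c : Fin (2 * k) → Fin (2 * k) → R} (hc : ∀ a b, c b a = -c a b)
    (σ : Equiv.Perm (Fin (2 * k))) (e : Fin k → Equiv.Perm (Fin 2)) :
    pairTerm c (σ * flipPerm e) = pairTerm c σ := by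
  have h (i : Fin k) : c ((σ * flipPerm e) (fstIdx i)) ((σ * flipPerm e) (sndIdx i)) =
      (Equiv.Perm.sign (e i) : ℂ) • c (σ (fstIdx i)) (σ (sndIdx i)) := by
    rw [Equiv.Perm.mul_apply, Equiv.Perm.mul_apply, flipPerm_fstIdx, flipPerm_sndIdx]
    have h2 : ∀ f : Equiv.Perm (Fin 2), f = 1 ∨ f = Equiv.swap 0 1 := by decide
    rcases h2 (e i) with hf | hf
    · simp [hf, pairIndex_zero, pairIndex_one]
    · rw [hf, Equiv.swap_apply_left, Equiv.swap_apply_right, pairIndex_zero, pairIndex_one,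
        Equiv.Perm.sign_swap (by decide), hc]
      simp
  have hs : ((∏ i, Equiv.Perm.sign (e i) : ℤˣ) : ℂ) * ∏ i, (Equiv.Perm.sign (e i) : ℂ) = 1 := by
    push_cast
    rw [← Finset.prod_mul_distrib]
    refine Finset.prod_eq_one fun i _ => ?_
    rcases Int.units_eq_one_or (Equiv.Perm.sign (e i)) with h | h <;> simp [h]
  rw [pairTerm, map_mul, sign_flipPerm, Finset.prod_congr rfl fun i _ => h i, Finset.prod_smul,
    smul_smul, Units.val_mul, Int.cast_mul, mul_assoc, hs, mul_one, pairTerm]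

/-- The terms are constant on left cosets of `Sym(2k,2)`, and at the even representatives the sign
is `1`. -/
theorem sum_pairTerm {c : Fin (2 * k) → Fin (2 * k) → R} (hc : ∀ a b, c b a = -c a b)
    {N : Finset (Equiv.Perm (Fin (2 * k)))} (hN : IsEvenCrossSection k N) :
    ∑ σ, pairTerm c σ = (Nat.card (pairSubgroup k) : ℂ) •
      ∑ ν ∈ N, ∏ i : Fin k, c (ν (fstIdx i)) (ν (sndIdx i)) := by
  classical
  have h1 : ∑ σ, pairTerm c σ =
      ∑ p : N × pairSubgroup k, pairTerm c (p.1.1 * p.2.1) :=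
    (Equiv.sum_comp (Equiv.ofBijective _ hN.isComplement) (pairTerm c)).symm
  have h2 (ν : N) (h : pairSubgroup k) : pairTerm c (ν.1 * h.1) =
      ∏ i : Fin k, c (ν.1 (fstIdx i)) (ν.1 (sndIdx i)) := by
    obtain ⟨π, e, he⟩ := exists_eq_blockPerm_mul_flipPerm h.2
    rw [he, ← mul_assoc, pairTerm_mul_flipPerm hc, pairTerm_mul_blockPerm, pairTerm,
      hN.even _ ν.2]
    simp
  rw [h1, Fintype.sum_prod_type]
  simp only [h2]
  rw [Finset.smul_sum, ← Finset.sum_coe_sort N]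
  refine Finset.sum_congr rfl fun ν _ => ?_
  rw [Finset.sum_const, Finset.card_univ, Nat.card_eq_fintype_card, Nat.cast_smul_eq_nsmul]

end Pairs

/-! ### The formula for `Γ` and the properties of the matching sums -/

section Main

variable {g : Type*} [LieRing g] [LieAlgebra ℂ g] {k : ℕ}

/-- The alternating sum of the tensor products of the brackets of pairs. -/
def bracketTensor (x : Fin (2 * k) → g) : TensorAlgebra ℂ g :=
  ∑ σ : Equiv.Perm (Fin (2 * k)), (Equiv.Perm.sign σ : ℂ) •
    TensorAlgebra.tprod ℂ g k (fun i => ⁅x (σ (fstIdx i)), x (σ (sndIdx i))⁆)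

/-- Permuting the `k` tensor factors amounts to right multiplication of `σ` by an even permutation,
so the tensor equals its average over `Perm (Fin k)`. -/
theorem bracketTensor_mem_symTensors (x : Fin (2 * k) → g) : bracketTensor x ∈ symTensors g := by
  have h1 (π : Equiv.Perm (Fin k)) : bracketTensor x =
      ∑ σ : Equiv.Perm (Fin (2 * k)), (Equiv.Perm.sign σ : ℂ) •
        TensorAlgebra.tprod ℂ g k (fun i => ⁅x (σ (fstIdx (π i))), x (σ (sndIdx (π i)))⁆) := by
    rw [bracketTensor, ← Equiv.sum_comp (Equiv.mulRight (blockPerm π))]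
    simp [sign_blockPerm, blockPerm_fstIdx, blockPerm_sndIdx]
  have h2 : (k.factorial : ℂ) • bracketTensor x =
      ∑ σ : Equiv.Perm (Fin (2 * k)), (Equiv.Perm.sign σ : ℂ) • ∑ π : Equiv.Perm (Fin k),
        TensorAlgebra.tprod ℂ g k (fun i => ⁅x (σ (fstIdx (π i))), x (σ (sndIdx (π i)))⁆) := by
    simp only [Finset.smul_sum]
    rw [Finset.sum_comm, Finset.sum_congr rfl fun π _ => (h1 π).symm]
    simp [Fintype.card_perm, ← Nat.cast_smul_eq_nsmul ℂ]
  have h3 : bracketTensor x = (k.factorial : ℂ)⁻¹ • (k.factorial : ℂ) • bracketTensor x := by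
    rw [smul_smul, inv_mul_cancel₀ (Nat.cast_ne_zero.2 k.factorial_ne_zero), one_smul]
  rw [h3, h2]
  refine Submodule.smul_mem _ _ (sum_mem fun σ _ => Submodule.smul_mem _ _ ?_)
  exact Submodule.subset_span ⟨k, fun i => ⁅x (σ (fstIdx i)), x (σ (sndIdx i))⁆, rfl⟩

attribute [local instance] LieRing.ofAssociativeRing in
-- The factor `1 / (2k)!` is the normalization of the alternating tensor; `2^{-k}` comes from
-- passing to commutators, which are brackets in `U(g)`.
theorem mkAlgHom_altTensor (x : Fin (2 * k) → g) :
    UniversalEnvelopingAlgebra.mkAlgHom ℂ g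
        (altTensor g (ExteriorAlgebra.ιMulti ℂ (2 * k) x)) =
      UniversalEnvelopingAlgebra.mkAlgHom ℂ g
        ((((2 * k).factorial : ℂ)⁻¹ * (2 ^ k : ℂ)⁻¹) • bracketTensor x) := by
  let τ := UniversalEnvelopingAlgebra.mkAlgHom ℂ g
  have hbr (y z : g) : τ (TensorAlgebra.ι ℂ y) * τ (TensorAlgebra.ι ℂ z) -
      τ (TensorAlgebra.ι ℂ z) * τ (TensorAlgebra.ι ℂ y) = τ (TensorAlgebra.ι ℂ ⁅y, z⁆) :=
    ((UniversalEnvelopingAlgebra.ι ℂ).map_lie y z).symm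
  have h := sum_sign_prod_eq fun i => τ (TensorAlgebra.ι ℂ (x i))
  simp only [hbr] at h
  have hl : UniversalEnvelopingAlgebra.mkAlgHom ℂ g
      (MultilinearMap.alternatization (TensorAlgebra.tprod ℂ g (2 * k)) x) =
      ∑ σ : Equiv.Perm (Fin (2 * k)), (Equiv.Perm.sign σ : ℂ) •
        (List.ofFn fun i => τ (TensorAlgebra.ι ℂ (x (σ i)))).prod := by
    rw [MultilinearMap.alternatization_apply, map_sum]
    refine Finset.sum_congr rfl fun σ _ => ?_
    rw [Units.smul_def, ← Int.cast_smul_eq_zsmul ℂ, map_smul, MultilinearMap.domDomCongr_apply,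
      TensorAlgebra.tprod_apply, map_list_prod, List.map_ofFn]
    rfl
  rw [altTensor, ExteriorAlgebra.liftAlternating_apply_ιMulti, AlternatingMap.smul_apply, map_smul,
    hl, h, smul_smul, map_smul, bracketTensor, map_sum]
  congr 1
  refine Finset.sum_congr rfl fun σ _ => ?_
  rw [map_smul, TensorAlgebra.tprod_apply, map_list_prod, List.map_ofFn]
  rfl

/-- The bracket tensor is symmetric and has the right image in `U(g)`; by injectivity it is the
tensor selected by `gammaT`. -/
theorem Gamma_ιMulti (hker : LinearMap.ker (symToEnveloping g) = ⊥) (x : Fin (2 * k) → g) :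
    Gamma g (ExteriorAlgebra.ιMulti ℂ (2 * k) x) =
      (((2 * k).factorial : ℂ)⁻¹ * (2 ^ k : ℂ)⁻¹) •
        ∑ σ, pairTerm (fun i j => SymmetricAlgebra.ι ℂ g ⁅x i, x j⁆) σ := by
  let s : symTensors g := (((2 * k).factorial : ℂ)⁻¹ * (2 ^ k : ℂ)⁻¹) •
    ⟨bracketTensor x, bracketTensor_mem_symTensors x⟩
  have h1 : gammaT g (altTensor g (ExteriorAlgebra.ιMulti ℂ (2 * k) x)) = s := by
    rw [← LinearMap.leftInverse_apply_of_inj hker s]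
    exact congrArg (symToEnveloping g).leftInverse (mkAlgHom_altTensor x)
  change SymmetricAlgebra.algHom ℂ g (gammaT g _ : symTensors g) = _
  rw [h1]
  change SymmetricAlgebra.algHom ℂ g (_ • bracketTensor x) = _
  rw [map_smul, bracketTensor, map_sum]
  congr 1
  refine Finset.sum_congr rfl fun σ _ => ?_
  rw [map_smul, TensorAlgebra.tprod_apply, map_list_prod, List.map_ofFn, List.prod_ofFn]
  rfl

theorem sum_pairTerm_eq_matchingSum {N : Finset (Equiv.Perm (Fin (2 * k)))}
    (hN : IsEvenCrossSection k N) (x : Fin (2 * k) → g) :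
    ∑ σ, pairTerm (fun i j => SymmetricAlgebra.ι ℂ g ⁅x i, x j⁆) σ =
      (Nat.card (pairSubgroup k) : ℂ) • matchingSum N x :=
  sum_pairTerm (fun a b => by rw [← lie_skew, map_neg]) hN

theorem matchingSum_mem_homogeneous (N : Finset (Equiv.Perm (Fin (2 * k)))) (x : Fin (2 * k) → g) :
    matchingSum N x ∈ homogeneous g k := by
  refine sum_mem fun ν _ => ?_
  have h (s : Finset (Fin k)) :
      ∏ i ∈ s, SymmetricAlgebra.ι ℂ g ⁅x (ν (fstIdx i)), x (ν (sndIdx i))⁆ ∈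
        LinearMap.range (SymmetricAlgebra.ι ℂ g) ^ s.card := by
    classical
    induction s using Finset.induction_on with
    | empty =>
      rw [Finset.prod_empty, Finset.card_empty, pow_zero]
      exact Submodule.one_le.1 le_rfl
    | insert i s hi ih =>
      rw [Finset.prod_insert hi, Finset.card_insert_of_notMem hi, pow_succ']
      exact Submodule.mul_mem_mul ⟨_, rfl⟩ ih
  have := h Finset.univ
  rwa [Finset.card_univ, Fintype.card_fin] at this

theorem isHarmonic_matchingSum {B : LinearMap.BilinForm ℂ g} (hB : IsInvariantForm B)
    {N : Finset (Equiv.Perm (Fin (2 * k)))} (hN : IsEvenCrossSection k N) (x : Fin (2 * k) → g) :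
    IsHarmonic B (matchingSum N x) := by
  intro p hp hp0
  have h := isHarmonic_topCoeffCenter_curvature_pow hB x k p hp hp0
  rw [topCoeffCenter_curvature_pow] at h
  have h' := sum_pairTerm_eq_matchingSum hN x
  simp only [pairTerm] at h'
  rw [h', map_smul] at h
  exact (smul_eq_zero.1 h).resolve_left (Nat.cast_ne_zero.2 Nat.card_pos.ne')

end Main

end KostantGamma

end

open KostantGamma in
theorem theorem9 {g : Type*} [LieRing g] [LieAlgebra ℂ g] [FiniteDimensional ℂ g]
    (hg : IsReductive g) (k : ℕ) :
    ∃ c : ℂ, c ≠ 0 ∧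
      ∀ N : Finset (Equiv.Perm (Fin (2 * k))), IsEvenCrossSection k N →
        (∀ x : Fin (2 * k) → g,
          Gamma g (ExteriorAlgebra.ιMulti ℂ (2 * k) x) = c • matchingSum N x) ∧
        (∀ x : Fin (2 * k) → g, matchingSum N x ∈ homogeneous g k ∧
          ∀ B : LinearMap.BilinForm ℂ g, IsInvariantForm B → IsHarmonic B (matchingSum N x)) ∧
        R g k = Submodule.span ℂ (Set.range fun x : Fin (2 * k) → g => matchingSum N x) := by
  -- The order of `Sym(2k,2)` is `2^k k!`, so this constant is `k! / (2k)!`; only its nonvanishing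
  -- is needed.
  have hc : ((2 * k).factorial : ℂ)⁻¹ * (2 ^ k : ℂ)⁻¹ * (Nat.card (pairSubgroup k) : ℂ) ≠ 0 :=
    mul_ne_zero (mul_ne_zero (inv_ne_zero (Nat.cast_ne_zero.2 (Nat.factorial_ne_zero _)))
      (inv_ne_zero (by simp))) (Nat.cast_ne_zero.2 Nat.card_pos.ne')
  refine ⟨_, hc, fun N hN => ?_⟩
  have hΓ (x : Fin (2 * k) → g) : Gamma g (ExteriorAlgebra.ιMulti ℂ (2 * k) x) =
      (((2 * k).factorial : ℂ)⁻¹ * (2 ^ k : ℂ)⁻¹ * (Nat.card (pairSubgroup k) : ℂ)) •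
        matchingSum N x := by
    rw [Gamma_ιMulti (ker_symToEnveloping hg), sum_pairTerm_eq_matchingSum hN, smul_smul]
  refine ⟨hΓ, fun x => ⟨matchingSum_mem_homogeneous N x, fun B hB =>
    isHarmonic_matchingSum hB hN x⟩, ?_⟩
  -- Decomposable elements span the exterior power, so `R g k` is spanned by the multiples `c •
  -- matchingSum N x`, and `c ≠ 0` can be divided out.
  rw [R, ← ExteriorAlgebra.ιMulti_span_fixedDegree, Submodule.map_span, ← Set.range_comp]
  have hr : Set.range (Gamma g ∘ ExteriorAlgebra.ιMulti ℂ (2 * k)) =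
      Set.range fun x : Fin (2 * k) → g => _ • matchingSum N x :=
    congrArg Set.range (funext hΓ)
  rw [hr]
  refine le_antisymm (Submodule.span_le.2 ?_) (Submodule.span_le.2 ?_)
  · rintro _ ⟨x, rfl⟩
    exact Submodule.smul_mem _ _ (Submodule.subset_span ⟨x, rfl⟩)
  · rintro _ ⟨x, rfl⟩
    exact (Submodule.smul_mem_iff _ hc).1 (Submodule.subset_span ⟨x, rfl⟩)
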